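/- Let $(A,\mathfrak m)$ be a one-dimensional Gorenstein complete local domain with algebraically closed residue field $A/\mathfrak m$. Let $V=\overline A$ be the integral closure of $A$ in its field of fractions and let $\mathfrak n$ be the maximal ideal of $V$. For $f\in V$ let $\mathrm{o}(f)$ denote the $\mathfrak n$-adic order of $f$, let $H_A=\{\mathrm{o}(f)\mid 0\neq f\in A\}\subseteq\mathbb N$ be the value semigroup of $A$, and let $\mathrm{c}(H_A)$ be its conductor, that is, the least integer $c\ge 0$ such that every integer $m\ge c$ belongs to $H_A$. Let $$G=\bigoplus_{\ell\ge 0}(\mathfrak n^{\ell}\cap A)/(\mathfrak n^{\ell+1}\cap A)$$ be the associated graded ring of $A$ with respect to the filtration $\{\mathfrak n^{\ell}\cap A\}_{\ell}$. Then $$\#\{I \mid I \text{ is a graded ideal of } G \text{ such that } G/I \text{ is Gorenstein and } \mu_G(I)\ge 2\}=\mathrm{c}(H_A),$$ where $\mu_G(I)$ denotes the minimal number of generators of the ideal $I$. (A ring is Gorenstein if it is Noetherian and its localization at each maximal ideal has finite injective dimension as a module over itself.) -/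

import Mathlib

universe u

/-- A ring is Gorenstein if it is Noetherian and each of its localizations at a maximal ideal
has finite injective dimension as a module over itself. -/
def IsGorensteinRing (R : Type u) [CommRing R] : Prop :=
  IsNoetherianRing R ∧
    ∀ (p : Ideal R) [p.IsMaximal], ∃ d : ℕ,
      CategoryTheory.HasInjectiveDimensionLE
        (ModuleCat.of (Localization.AtPrime p) (Localization.AtPrime p)) d

/-- A (decreasing, multiplicative) filtration of ideals
`A = F 0 ⊇ F 1 ⊇ F 2 ⊇ ⋯` with `F i * F j ⊆ F (i + j)`. -/
structure IdealFiltration (A : Type u) [CommRing A] where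
  ideal : ℕ → Ideal A
  ideal_zero : ideal 0 = ⊤
  antitone : Antitone ideal
  mul_le : ∀ i j, ideal i * ideal j ≤ ideal (i + j)

namespace IdealFiltration

variable {A : Type u} [CommRing A] (F : IdealFiltration A)

/-- The degree `i` piece `F i / F (i + 1)`. -/
abbrev GrPiece (i : ℕ) : Type u :=
  (F.ideal i) ⧸ (F.ideal (i + 1)).submoduleOf (F.ideal i)

/-- The class in `F i / F (i + 1)` of an element of `F i`. -/
def cls (i : ℕ) (x : F.ideal i) : F.GrPiece i :=
  Submodule.Quotient.mk x

theorem cls_surjective (i : ℕ) : Function.Surjective (F.cls i) :=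
  Submodule.Quotient.mk_surjective _

theorem cls_eq_iff {i : ℕ} {x y : F.ideal i} :
    F.cls i x = F.cls i y ↔ (x - y : A) ∈ F.ideal (i + 1) := by
  exact Submodule.Quotient.eq _

theorem mul_mem {i j : ℕ} (x : F.ideal i) (y : F.ideal j) : (x * y : A) ∈ F.ideal (i + j) :=
  F.mul_le i j (Ideal.mul_mem_mul x.2 y.2)

/-- The product of a class in `F i / F (i + 1)` and a class in `F j / F (j + 1)`: the class of
the product of representatives, in `F (i + j) / F (i + j + 1)`. -/
def grMul {i j : ℕ} : F.GrPiece i → F.GrPiece j → F.GrPiece (i + j) :=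
  Quotient.map₂ (fun x y => ⟨x * y, F.mul_mem x y⟩) (by
    intro a b hab c d hcd
    have h1 : (a - b : A) ∈ F.ideal (i + 1) := F.cls_eq_iff.1 (Quotient.sound hab)
    have h2 : (c - d : A) ∈ F.ideal (j + 1) := F.cls_eq_iff.1 (Quotient.sound hcd)
    refine Quotient.exact (F.cls_eq_iff.2 ?_ : F.cls (i + j) _ = F.cls (i + j) _)
    have e : (a * c - b * d : A) = (a - b) * c + b * (c - d) := by ring
    have h3 : ((a - b) * c : A) ∈ F.ideal (i + j + 1) := by
      have := F.mul_mem ⟨_, h1⟩ c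
      rwa [add_right_comm] at this
    have h4 : (b * (c - d) : A) ∈ F.ideal (i + j + 1) := F.mul_mem b ⟨_, h2⟩
    simpa only [e] using add_mem h3 h4)

theorem grMul_cls {i j : ℕ} (x : F.ideal i) (y : F.ideal j) :
    F.grMul (F.cls i x) (F.cls j y) = F.cls (i + j) ⟨x * y, F.mul_mem x y⟩ := rfl

theorem cls_add {i : ℕ} (x y : F.ideal i) : F.cls i (x + y) = F.cls i x + F.cls i y := rfl

theorem cls_zero {i : ℕ} : F.cls i 0 = 0 := rfl

theorem mk_cls_eq {i j : ℕ} (h : i = j) (x : F.ideal i) (y : F.ideal j) (hxy : (x : A) = y) :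
    (GradedMonoid.mk i (F.cls i x) : GradedMonoid F.GrPiece) = GradedMonoid.mk j (F.cls j y) := by
  subst h
  rw [Subtype.ext hxy]

/-- An element of `A = F 0`, as an element of `F 0`. -/
def ofRing (a : A) : F.ideal 0 := ⟨a, F.ideal_zero ▸ Submodule.mem_top⟩

instance grGMul : GradedMonoid.GMul F.GrPiece where
  mul := F.grMul

instance grGOne : GradedMonoid.GOne F.GrPiece where
  one := F.cls 0 (F.ofRing 1)

instance grGCommRing : DirectSum.GCommRing F.GrPiece where
  mul_zero {i j} a := by
    obtain ⟨a, rfl⟩ := F.cls_surjective _ a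
    rw [← F.cls_zero, ← F.cls_zero]
    change F.grMul (F.cls _ _) (F.cls _ _) = _
    rw [grMul_cls]
    congr 1; ext; simp
  zero_mul {i j} a := by
    obtain ⟨a, rfl⟩ := F.cls_surjective _ a
    rw [← F.cls_zero, ← F.cls_zero]
    change F.grMul (F.cls _ _) (F.cls _ _) = _
    rw [grMul_cls]
    congr 1; ext; simp
  mul_add {i j} a b c := by
    obtain ⟨a, rfl⟩ := F.cls_surjective _ a
    obtain ⟨b, rfl⟩ := F.cls_surjective _ b
    obtain ⟨c, rfl⟩ := F.cls_surjective _ c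
    rw [← F.cls_add]
    change F.grMul (F.cls _ _) (F.cls _ _) =
      F.grMul (F.cls _ _) (F.cls _ _) + F.grMul (F.cls _ _) (F.cls _ _)
    rw [grMul_cls, grMul_cls, grMul_cls, ← F.cls_add]
    congr 1; ext; simp [mul_add]
  add_mul {i j} a b c := by
    obtain ⟨a, rfl⟩ := F.cls_surjective _ a
    obtain ⟨b, rfl⟩ := F.cls_surjective _ b
    obtain ⟨c, rfl⟩ := F.cls_surjective _ c
    rw [← F.cls_add]
    change F.grMul (F.cls _ _) (F.cls _ _) =
      F.grMul (F.cls _ _) (F.cls _ _) + F.grMul (F.cls _ _) (F.cls _ _)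
    rw [grMul_cls, grMul_cls, grMul_cls, ← F.cls_add]
    congr 1; ext; simp [add_mul]
  one_mul := by
    rintro ⟨i, a⟩
    obtain ⟨a, rfl⟩ := F.cls_surjective _ a
    exact F.mk_cls_eq (zero_add i) _ _ (one_mul _)
  mul_one := by
    rintro ⟨i, a⟩
    obtain ⟨a, rfl⟩ := F.cls_surjective _ a
    exact F.mk_cls_eq (add_zero i) _ _ (mul_one _)
  mul_assoc := by
    rintro ⟨i, a⟩ ⟨j, b⟩ ⟨k, c⟩
    obtain ⟨a, rfl⟩ := F.cls_surjective _ a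
    obtain ⟨b, rfl⟩ := F.cls_surjective _ b
    obtain ⟨c, rfl⟩ := F.cls_surjective _ c
    exact F.mk_cls_eq (add_assoc i j k) _ _ (mul_assoc _ _ _)
  mul_comm := by
    rintro ⟨i, a⟩ ⟨j, b⟩
    obtain ⟨a, rfl⟩ := F.cls_surjective _ a
    obtain ⟨b, rfl⟩ := F.cls_surjective _ b
    exact F.mk_cls_eq (add_comm i j) _ _ (mul_comm _ _)
  natCast n := F.cls 0 (F.ofRing n)
  natCast_zero := by
    rw [← F.cls_zero]; congr 1; ext; simp [ofRing]
  natCast_succ n := by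
    change F.cls 0 _ = F.cls 0 _ + F.cls 0 _
    rw [← F.cls_add]; congr 1; ext; simp [ofRing]
  intCast n := F.cls 0 (F.ofRing n)
  intCast_ofNat n := by
    change F.cls 0 _ = F.cls 0 _
    congr 1; ext; simp [ofRing]
  intCast_negSucc_ofNat n := by
    change F.cls 0 _ = - F.cls 0 _
    rw [show - F.cls 0 (F.ofRing ((n + 1 : ℕ) : A)) = F.cls 0 (- F.ofRing ((n + 1 : ℕ) : A))
      from rfl]
    congr 1; ext; simp [ofRing]

/-- The associated graded ring `⨁ i, F i / F (i + 1)`. -/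
abbrev AssociatedGraded : Type u := DirectSum ℕ F.GrPiece

noncomputable instance : CommRing F.AssociatedGraded :=
  DirectSum.commRing F.GrPiece

/-- An ideal of the associated graded ring is graded if it contains all homogeneous components
of each of its elements. -/
def IsGradedIdeal (I : Ideal F.AssociatedGraded) : Prop :=
  ∀ x ∈ I, ∀ i : ℕ, DirectSum.of F.GrPiece i (x i) ∈ I

/-- The set of graded ideals `I` of the associated graded ring `G` such that `G / I` is Gorenstein
and `I` cannot be generated by fewer than two elements. -/
def gorensteinGradedIdeals : Set (Ideal F.AssociatedGraded) :=
  {I | F.IsGradedIdeal I ∧ IsGorensteinRing (F.AssociatedGraded ⧸ I) ∧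
    2 ≤ Submodule.spanRank I}

end IdealFiltration

/-- The filtration `n ^ i ∩ A` of `A` induced by the powers of an ideal `n` of an
`A`-algebra `V`. -/
def inducedFiltration (A : Type u) [CommRing A] {V : Type u} [CommRing V] [Algebra A V]
    (n : Ideal V) : IdealFiltration A where
  ideal i := (n ^ i).comap (algebraMap A V)
  ideal_zero := by simp
  antitone _ _ h := Ideal.comap_mono (Ideal.pow_le_pow_right h)
  mul_le i j := by
    rw [pow_add]
    exact Ideal.le_comap_mul _

/-- The `n`-adic order of `f`: the supremum of all `i` with `f ∈ n ^ i`. -/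
noncomputable def adicOrder {V : Type u} [CommRing V] (n : Ideal V) (f : V) : ℕ∞ :=
  ⨆ i ∈ {i : ℕ | f ∈ n ^ i}, (i : ℕ∞)

/-- The set of `n`-adic orders of the nonzero elements of `A`; this is the value semigroup of `A`
when `V` is the normalization of `A`, a discrete valuation ring with maximal ideal `n`. -/
def valueSemigroup (A : Type u) [CommRing A] {V : Type u} [CommRing V] [Algebra A V]
    (n : Ideal V) : Set ℕ :=
  {h | ∃ f : A, f ≠ 0 ∧ adicOrder n (algebraMap A V f) = h}

/-- The conductor of a numerical semigroup: the least `c` such that every integer `≥ c`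
belongs to `H`. -/
noncomputable def semigroupConductor (H : Set ℕ) : ℕ :=
  sInf {c : ℕ | ∀ m : ℕ, c ≤ m → m ∈ H}

/-! Write `V` for the integral closure, `H` for the value semigroup and `c` for its conductor. Since
`A` is complete, `V` is a discrete valuation ring finite over `A`; since the residue field of `A` is
algebraically closed, it is also that of `V`. Hence the graded ring `G` behaves like the semigroup
ring of `H`: nonzero homogeneous elements of equal degree are multiples of each other, and products
of nonzero homogeneous elements are nonzero (`IdealFiltration.IsMonomial`). A graded ideal `I` is
therefore determined by its set of degrees `E`, an ideal of `H`.

If `I` is nonzero and proper, then `G ⧸ I` is Artinian local, and it is Gorenstein exactly when its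
socle is simple. In terms of degrees, `E` consists of those `h ∈ H` with `s ∉ h + H`, for a unique
`s ∈ H` (`exists_degrees_eq_nonDivisors`, `isGorensteinRing_quotient`). Moreover `I` is principal
exactly when `E = a + H` for some `a ∈ H`. Because `A` is Gorenstein, `H` is symmetric: the socle of
`K / A` is simple, and this forces `F - i ∈ H` for each gap `i`, where `F = c - 1`
(`mem_valueSemigroup_of_notMem`). Symmetry makes `E = a + H` equivalent to `s = a + c - 1`
(`exists_nonDivisors_eq_iff`).

What remains is to count the `s ∈ H` with `s - (c - 1) ∉ H`. They are the elements of `H` below `c`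
together with the shifts by `c - 1` of the gaps of `H`; these two families are indexed by the
integers in `[0, c)`. -/

/-! ### Finite injective dimension and simple socles -/

section Homological

open CategoryTheory

theorem Module.Injective.exists_smul_eq_of_mem_nonZeroDivisors {R : Type u} [CommRing R]
    {M : Type u} [AddCommGroup M] [Module R M] (hM : Module.Injective R M) {x : R}
    (hx : x ∈ nonZeroDivisors R) (z : M) : ∃ z' : M, x • z' = z := by
  obtain ⟨h, hh⟩ := hM.out (LinearMap.mulLeft R x)
    (fun a b hab => by
      have : a * x = b * x := by simpa [mul_comm] using hab
      exact (mul_cancel_right_mem_nonZeroDivisors hx).1 this)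
    (LinearMap.toSpanSingleton R M z)
  refine ⟨h 1, ?_⟩
  have := hh 1
  simp only [LinearMap.mulLeft_apply, mul_one, LinearMap.toSpanSingleton_apply, one_smul] at this
  rw [← this, ← map_smul, smul_eq_mul, mul_one]

/-- If maps from all cyclic modules `R ⧸ p` with `p` prime lift along `π : I → J` with `I` injective,
then maps from all finite modules lift. -/
theorem exists_comp_eq_of_forall_prime {R : Type u} [CommRing R] [IsNoetherianRing R]
    {I J : Type u} [AddCommGroup I] [Module R I] [AddCommGroup J] [Module R J]
    (hI : Module.Injective R I) (π : I →ₗ[R] J)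
    (H : ∀ p : Ideal R, p.IsPrime → ∀ f : (R ⧸ p) →ₗ[R] J, ∃ g : (R ⧸ p) →ₗ[R] I, π ∘ₗ g = f)
    (M : Type u) [AddCommGroup M] [Module R M] [hM : Module.Finite R M] :
    ∀ f : M →ₗ[R] J, ∃ g : M →ₗ[R] I, π ∘ₗ g = f := by
  induction hM using IsNoetherianRing.induction_on_isQuotientEquivQuotientPrime R with
  | subsingleton N =>
    intro f
    refine ⟨0, ?_⟩
    ext x
    rw [Subsingleton.elim x 0]; simp
  | quotient N p e =>
    intro f
    obtain ⟨g, hg⟩ := H p.1 p.2 (f ∘ₗ e.symm.toLinearMap)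
    refine ⟨g ∘ₗ e.toLinearMap, ?_⟩
    ext x
    simpa using LinearMap.congr_fun hg (e x)
  | exact N₁ N₂ N₃ φ ψ hφ hψ hex h₁ h₃ =>
    intro f
    obtain ⟨g₁, hg₁⟩ := h₁ (f ∘ₗ φ)
    obtain ⟨g₂, hg₂⟩ := hI.out φ hφ g₁
    have hker : LinearMap.ker ψ ≤ LinearMap.ker (f - π ∘ₗ g₂) := by
      intro x hx
      obtain ⟨y, rfl⟩ := (hex x).1 hx
      have := LinearMap.congr_fun hg₁ y
      simp only [LinearMap.comp_apply] at this
      simp [hg₂, this]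
    let e := ψ.quotKerEquivOfSurjective hψ
    obtain ⟨g₃, hg₃⟩ := h₃ ((LinearMap.ker ψ).liftQ _ hker ∘ₗ e.symm.toLinearMap)
    refine ⟨g₂ + g₃ ∘ₗ ψ, ?_⟩
    ext x
    have := LinearMap.congr_fun hg₃ (ψ x)
    have he : e.symm (ψ x) = Submodule.Quotient.mk x := by
      rw [LinearEquiv.symm_apply_eq]; rfl
    simp only [LinearMap.comp_apply, LinearEquiv.coe_coe, he, Submodule.liftQ_apply,
      LinearMap.sub_apply] at this
    simp [this]

/-- Extend a map from an ideal `a` to `C` to a map `h : R → I`. Then `π ∘ h` kills `a`; lifting the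
induced map `R ⧸ a → J` to `I` and subtracting the lift from `h` moves the extension back into `C`.
-/
theorem Module.Baer.of_exact_of_forall_exists_comp_eq {R : Type u} [CommRing R]
    {C I J : Type u} [AddCommGroup C] [Module R C] [AddCommGroup I] [Module R I] [AddCommGroup J]
    [Module R J] (hI : Module.Injective R I) {i : C →ₗ[R] I} {π : I →ₗ[R] J}
    (hi : Function.Injective i) (hex : Function.Exact i π)
    (H : ∀ a : Ideal R, ∀ f : (R ⧸ a) →ₗ[R] J, ∃ g : (R ⧸ a) →ₗ[R] I, π ∘ₗ g = f) :
    Module.Baer R C := by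
  intro a g
  obtain ⟨h, hh⟩ := hI.out a.subtype (Subtype.val_injective) (i ∘ₗ g)
  have hker : a ≤ LinearMap.ker (π ∘ₗ h) := by
    intro x hx
    have := hh ⟨x, hx⟩
    simp only [Submodule.subtype_apply, LinearMap.comp_apply] at this
    simp [this, hex.apply_apply_eq_zero]
  obtain ⟨v, hv⟩ := H a (Submodule.liftQ a (π ∘ₗ h) hker)
  obtain ⟨c, hc⟩ := (hex (h 1 - v (Submodule.Quotient.mk 1))).1 (by
    have := LinearMap.congr_fun hv (Submodule.Quotient.mk 1)
    simp only [LinearMap.comp_apply, Submodule.liftQ_apply] at this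
    rw [map_sub, this, sub_self])
  refine ⟨LinearMap.toSpanSingleton R C c, fun x hx => hi ?_⟩
  have h1 := hh ⟨x, hx⟩
  simp only [Submodule.subtype_apply, LinearMap.comp_apply] at h1
  rw [LinearMap.toSpanSingleton_apply, map_smul, hc, smul_sub, ← map_smul, ← map_smul, smul_eq_mul,
    mul_one, h1, ← Submodule.Quotient.mk_smul, smul_eq_mul, mul_one,
    (Submodule.Quotient.mk_eq_zero a).2 hx, map_zero, sub_zero]

section LocalRing

variable {R : Type u} [CommRing R] [IsLocalRing R]

/-- Over a local ring, if the residue field embeds in `R ⧸ (x)` and `C` is `x`-divisible, then maps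
from the residue field lift along `π : I → J`, where `0 → C → I → J → 0` is exact and `J` is
injective. -/
theorem exists_comp_eq_residueField
    {C I J : Type u} [AddCommGroup C] [Module R C] [AddCommGroup I] [Module R I] [AddCommGroup J]
    [Module R J] (hJ : Module.Injective R J) {i : C →ₗ[R] I} {π : I →ₗ[R] J}
    (hπ : Function.Surjective π) (hex : Function.Exact i π)
    {x y : R} (hy : y ∉ Ideal.span {x})
    (hmy : ∀ r ∈ IsLocalRing.maximalIdeal R, r * y ∈ Ideal.span {x})
    (hC : x = 0 ∨ ∀ c : C, ∃ c' : C, x • c' = c)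
    (f : (R ⧸ IsLocalRing.maximalIdeal R) →ₗ[R] J) :
    ∃ g : (R ⧸ IsLocalRing.maximalIdeal R) →ₗ[R] I, π ∘ₗ g = f := by
  let m := IsLocalRing.maximalIdeal R
  let ε₀ : R →ₗ[R] R ⧸ Ideal.span {x} := LinearMap.toSpanSingleton R _ (Submodule.Quotient.mk y)
  have hε₀ (r : R) : ε₀ r = 0 ↔ r * y ∈ Ideal.span {x} := by
    rw [LinearMap.toSpanSingleton_apply, ← Submodule.Quotient.mk_smul, smul_eq_mul,
      Submodule.Quotient.mk_eq_zero]
  have hker : LinearMap.ker ε₀ = m := by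
    ext r
    rw [LinearMap.mem_ker, hε₀]
    refine ⟨fun h => ?_, hmy r⟩
    by_contra hr
    obtain ⟨u, rfl⟩ := IsLocalRing.notMem_maximalIdeal.1 hr
    exact hy (by simpa using Ideal.mul_mem_left _ (↑u⁻¹ : R) h)
  let ε : (R ⧸ m) →ₗ[R] R ⧸ Ideal.span {x} := m.liftQ ε₀ hker.ge
  have hε : Function.Injective ε := by
    rw [← LinearMap.ker_eq_bot]
    exact Submodule.ker_liftQ_eq_bot _ _ _ hker.le
  obtain ⟨h, hh⟩ := hJ.out ε hε f
  obtain ⟨z, hz⟩ := hπ (h (Submodule.Quotient.mk 1))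
  have hxj : x • h (Submodule.Quotient.mk 1) = 0 := by
    rw [← map_smul, ← Submodule.Quotient.mk_smul, smul_eq_mul, mul_one,
      (Submodule.Quotient.mk_eq_zero _).2 (Ideal.mem_span_singleton_self x), map_zero]
  -- An `x`-torsion element of `J` lifts to an `x`-torsion element of `I`: the obstruction `x • z`
  -- lies in `C`, where it can be divided by `x`.
  obtain ⟨z', hz', hxz'⟩ : ∃ z', π z' = h (Submodule.Quotient.mk 1) ∧ x • z' = 0 := by
    rcases hC with rfl | hC
    · exact ⟨z, hz, zero_smul _ _⟩
    · obtain ⟨c, hc⟩ := (hex (x • z)).1 (by rw [map_smul, hz, hxj])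
      obtain ⟨c', rfl⟩ := hC c
      refine ⟨z - i c', ?_, ?_⟩
      · rw [map_sub, hz, hex.apply_apply_eq_zero, sub_zero]
      · rw [smul_sub, ← map_smul, hc, sub_self]
  refine ⟨m.liftQ (LinearMap.toSpanSingleton R I (y • z')) ?_, ?_⟩
  · intro r hr
    obtain ⟨s, hs⟩ := Ideal.mem_span_singleton'.1 (hmy r hr)
    rw [LinearMap.mem_ker, LinearMap.toSpanSingleton_apply, smul_smul, ← hs, mul_smul, hxz',
      smul_zero]
  · refine Submodule.linearMap_qext _ (LinearMap.ext_ring ?_)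
    have h1 := hh (Submodule.Quotient.mk 1)
    change π (LinearMap.toSpanSingleton R I (y • z') 1) = f (Submodule.Quotient.mk 1)
    rw [← h1, LinearMap.toSpanSingleton_apply, one_smul, map_smul, hz', ← map_smul]
    congr 1
    change _ = ε₀ 1
    rw [LinearMap.toSpanSingleton_apply, one_smul, ← Submodule.Quotient.mk_smul, smul_eq_mul,
      mul_one]

/-- Over a Noetherian local ring of dimension at most one, under a depth condition
expressed by `x` and `y`, divisible modules of finite injective dimension are injective. -/
theorem Module.injective_of_hasInjectiveDimensionLE [IsNoetherianRing R]
    (hp : ∀ p : Ideal R, p.IsPrime → p = IsLocalRing.maximalIdeal R ∨ p = ⊥)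
    {x y : R} (hx : x = 0 ∨ x ∈ nonZeroDivisors R) (hy : y ∉ Ideal.span {x})
    (hmy : ∀ r ∈ IsLocalRing.maximalIdeal R, r * y ∈ Ideal.span {x}) (d : ℕ) :
    ∀ C : ModuleCat.{u} R, (x = 0 ∨ ∀ c : C, ∃ c' : C, x • c' = c) →
      HasInjectiveDimensionLE C d → Module.Injective R C := by
  induction d with
  | zero =>
    intro C _ h
    have : CategoryTheory.Injective C := injective_iff_hasInjectiveDimensionLT_one.2 h
    exact Module.injective_module_of_injective_object R C
  | succ n ih =>
    intro C hC h
    obtain ⟨I, hI, i, hi⟩ := EnoughInjectives.presentation C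
    have hI' : Module.Injective R I := Module.injective_module_of_injective_object R I
    have hinj : Function.Injective i.hom := (ModuleCat.mono_iff_injective i).1 hi
    let S : ShortComplex (ModuleCat.{u} R) :=
      ModuleCat.shortComplexOfCompEqZero _ _ i.hom.exact_map_mkQ_range.linearMap_comp_eq_zero
    have exactS : S.ShortExact := ModuleCat.shortComplex_shortExact S
      i.hom.exact_map_mkQ_range hinj (Submodule.mkQ_surjective _)
    have h3 : HasInjectiveDimensionLE S.X₃ n := (exactS.hasInjectiveDimensionLT_X₃_iff n hI).2 h
    have hJ : Module.Injective R (I ⧸ LinearMap.range i.hom) := by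
      -- The cosyzygy is a quotient of an injective module, so it is again divisible by `x` and the
      -- induction applies to it.
      refine ih S.X₃ ?_ h3
      refine hx.imp_right fun hx c => ?_
      obtain ⟨c, rfl⟩ := Submodule.mkQ_surjective _ c
      obtain ⟨z, hz⟩ := hI'.exists_smul_eq_of_mem_nonZeroDivisors hx c
      exact ⟨Submodule.mkQ _ z, by rw [← map_smul, hz]⟩
    refine Module.Baer.iff_injective.1 <| Module.Baer.of_exact_of_forall_exists_comp_eq hI' hinj
      i.hom.exact_map_mkQ_range fun a => ?_
    refine exists_comp_eq_of_forall_prime hI' _ (fun p hpp f => ?_) _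
    rcases hp p hpp with rfl | rfl
    · exact exists_comp_eq_residueField hJ (Submodule.mkQ_surjective _) i.hom.exact_map_mkQ_range
        hy hmy hC f
    · have : Module.Projective R (R ⧸ (⊥ : Ideal R)) :=
        Module.Projective.of_equiv (Submodule.quotEquivOfEqBot (⊥ : Ideal R) rfl).symm
      exact Module.projective_lifting_property _ f (Submodule.mkQ_surjective _)

end LocalRing

/-- A nonzero socle element spans a copy of the residue field, and a map from this submodule extends
to all of `M` by injectivity. -/
theorem Module.Injective.exists_end_apply_eq {R : Type u} [CommRing R] [IsLocalRing R]
    {M : Type u} [AddCommGroup M] [Module R M] (hM : Module.Injective R M) {s s' : M} (hs : s ≠ 0)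
    (hms : ∀ r ∈ IsLocalRing.maximalIdeal R, r • s = 0)
    (hms' : ∀ r ∈ IsLocalRing.maximalIdeal R, r • s' = 0) : ∃ h : M →ₗ[R] M, h s = s' := by
  let m := IsLocalRing.maximalIdeal R
  let ε : (R ⧸ m) →ₗ[R] M := m.liftQ (LinearMap.toSpanSingleton R M s) hms
  let ε' : (R ⧸ m) →ₗ[R] M := m.liftQ (LinearMap.toSpanSingleton R M s') hms'
  have hε : Function.Injective ε := by
    rw [← LinearMap.ker_eq_bot]
    refine Submodule.ker_liftQ_eq_bot _ _ _ fun r hr => ?_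
    by_contra hr'
    obtain ⟨u, rfl⟩ := IsLocalRing.notMem_maximalIdeal.1 hr'
    rw [LinearMap.mem_ker, LinearMap.toSpanSingleton_apply] at hr
    exact hs (by simpa [smul_smul] using congrArg ((↑u⁻¹ : R) • ·) hr)
  obtain ⟨h, hh⟩ := hM.out ε hε ε'
  refine ⟨h, ?_⟩
  have h1 : ε (Submodule.Quotient.mk 1) = s := one_smul R s
  have h2 : ε' (Submodule.Quotient.mk 1) = s' := one_smul R s'
  rw [← h1, ← h2, hh]

/-- An associated prime of `R ⧸ I` contains `I`, so it is the maximal ideal; `y` represents an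
element with this annihilator. -/
theorem IsLocalRing.exists_notMem_forall_mul_mem {R : Type u} [CommRing R] [IsLocalRing R]
    [IsNoetherianRing R] {I : Ideal R} (hI : I ≠ ⊤)
    (hp : ∀ p : Ideal R, p.IsPrime → I ≤ p → p = IsLocalRing.maximalIdeal R) :
    ∃ y : R, y ∉ I ∧ ∀ r ∈ IsLocalRing.maximalIdeal R, r * y ∈ I := by
  have : Nontrivial (R ⧸ I) := Ideal.Quotient.nontrivial_iff.2 hI
  obtain ⟨p, hpa⟩ := associatedPrimes.nonempty R (R ⧸ I)
  have hpp : p.IsPrime := hpa.isPrime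
  have hann := hpa.annihilator_le
  have hIp : I ≤ p := by
    refine le_trans ?_ hann
    rw [Submodule.annihilator_top, Ideal.annihilator_quotient]
  obtain rfl := hp p hpp hIp
  obtain ⟨y, hy⟩ := ((isAssociatedPrime_iff_exists_injective_linearMap _ _).1 hpa).2
  obtain ⟨z, hz⟩ := Submodule.mkQ_surjective _ (y (Submodule.Quotient.mk 1))
  have key (r : R) : r * z ∈ I ↔ r ∈ IsLocalRing.maximalIdeal R := by
    rw [← Submodule.Quotient.mk_eq_zero I, ← smul_eq_mul, Submodule.Quotient.mk_smul]
    change r • Submodule.mkQ I z = 0 ↔ _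
    rw [hz, ← map_smul, map_eq_zero_iff y hy, ← Submodule.Quotient.mk_smul,
      Submodule.Quotient.mk_eq_zero, smul_eq_mul, mul_one]
  refine ⟨z, fun h => ?_, fun r hr => (key r).2 hr⟩
  have := (key 1).1 (by simpa using h)
  exact (Ideal.ne_top_iff_one _).1 hpp.ne_top this

theorem IsArtinianRing.injective_self_of_hasInjectiveDimensionLE {R : Type u} [CommRing R]
    [IsLocalRing R] [IsArtinianRing R] {d : ℕ}
    (h : HasInjectiveDimensionLE (ModuleCat.of R R) d) : Module.Injective R R := by
  have hmax (p : Ideal R) (hp : p.IsPrime) : p = IsLocalRing.maximalIdeal R :=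
    IsLocalRing.eq_maximalIdeal inferInstance
  obtain ⟨y, hy, hmy⟩ := IsLocalRing.exists_notMem_forall_mul_mem (R := R) (I := Ideal.span {0})
    (by simp) (fun p hp _ => hmax p hp)
  exact Module.injective_of_hasInjectiveDimensionLE (fun p hp => Or.inl (hmax p hp))
    (Or.inl rfl) hy hmy d (ModuleCat.of R R) (Or.inl rfl) h

/-- `R` is self-injective, and its endomorphisms are multiplications, so its socle is generated by
any of its nonzero elements. -/
theorem IsArtinianRing.exists_eq_mul_of_hasInjectiveDimensionLE {R : Type u} [CommRing R]
    [IsLocalRing R] [IsArtinianRing R] {d : ℕ}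
    (h : HasInjectiveDimensionLE (ModuleCat.of R R) d) {s s' : R} (hs : s ≠ 0)
    (hms : ∀ r ∈ IsLocalRing.maximalIdeal R, r * s = 0)
    (hms' : ∀ r ∈ IsLocalRing.maximalIdeal R, r * s' = 0) : ∃ r, s' = r * s := by
  obtain ⟨f, hf⟩ := (injective_self_of_hasInjectiveDimensionLE h).exists_end_apply_eq hs hms hms'
  refine ⟨f 1, ?_⟩
  rw [← hf, mul_comm, ← smul_eq_mul, ← map_smul, smul_eq_mul, mul_one]

theorem IsFractionRing.moduleInjective {A K : Type u} [CommRing A] [IsDomain A] [Field K] [Algebra A K]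
    [IsFractionRing A K] : Module.Injective A K := by
  rw [← Module.Baer.iff_injective]
  intro I g
  by_cases hI : I = ⊥
  · subst hI
    refine ⟨0, fun x hx => ?_⟩
    have : (⟨x, hx⟩ : (⊥ : Ideal A)) = 0 := Subsingleton.elim _ _
    rw [this]; simp
  · obtain ⟨a, ha, ha0⟩ := Submodule.exists_mem_ne_zero_of_ne_bot hI
    have ha0' : algebraMap A K a ≠ 0 := by simpa using ha0
    refine ⟨LinearMap.toSpanSingleton A K (g ⟨a, ha⟩ / algebraMap A K a), fun x hx => ?_⟩
    have h1 : a • g ⟨x, hx⟩ = x • g ⟨a, ha⟩ := by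
      rw [← map_smul, ← map_smul]
      congr 1
      exact Subtype.ext (mul_comm _ _)
    rw [LinearMap.toSpanSingleton_apply, Algebra.smul_def]
    rw [Algebra.smul_def, Algebra.smul_def] at h1
    field_simp
    rw [h1, mul_comm]

/-- If `A` is a one-dimensional Noetherian local domain of finite injective dimension over itself,
the socle of `K / A` is simple, where `K` is the fraction field. -/
theorem IsLocalRing.exists_sub_smul_mem_range_of_hasInjectiveDimensionLE
    {A K : Type u} [CommRing A] [IsDomain A] [IsLocalRing A] [IsNoetherianRing A]
    [Ring.DimensionLEOne A] [Field K] [Algebra A K] [IsFractionRing A K]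
    (hA : ¬ IsField A) {d : ℕ} (h : HasInjectiveDimensionLE (ModuleCat.of A A) d) {s s' : K}
    (hs : s ∉ Set.range (algebraMap A K))
    (hms : ∀ r ∈ IsLocalRing.maximalIdeal A, r • s ∈ Set.range (algebraMap A K))
    (hms' : ∀ r ∈ IsLocalRing.maximalIdeal A, r • s' ∈ Set.range (algebraMap A K)) :
    ∃ r : A, s' - r • s ∈ Set.range (algebraMap A K) := by
  have hmax (p : Ideal A) (hp : p.IsPrime) (hp0 : p ≠ ⊥) : p = IsLocalRing.maximalIdeal A :=
    IsLocalRing.eq_maximalIdeal (Ring.DimensionLEOne.maximalOfPrime hp0 hp)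
  obtain ⟨x, hxm, hx0⟩ := Submodule.exists_mem_ne_zero_of_ne_bot
    (mt IsLocalRing.isField_iff_maximalIdeal_eq.2 hA)
  obtain ⟨y, hy, hmy⟩ := IsLocalRing.exists_notMem_forall_mul_mem (R := A) (I := Ideal.span {x})
    (by rwa [Ne, Ideal.span_singleton_eq_top, ← mem_nonunits_iff, ← IsLocalRing.mem_maximalIdeal])
    (fun p hp hxp => hmax p hp (by
      rintro rfl
      exact hx0 (by simpa using hxp (Ideal.mem_span_singleton_self x))))
  let N : Submodule A K := LinearMap.range (Algebra.linearMap A K)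
  have hN (z : K) : z ∈ N ↔ z ∈ Set.range (algebraMap A K) := Iff.rfl
  have hK : Module.Injective A K := IsFractionRing.moduleInjective
  have hx0' : algebraMap A K x ≠ 0 := by simpa using hx0
  have hKA : Module.Injective A (K ⧸ N) := by
    let S : ShortComplex (ModuleCat.{u} A) := ModuleCat.shortComplexOfCompEqZero
      (Algebra.linearMap A K) N.mkQ (LinearMap.exact_map_mkQ_range _).linearMap_comp_eq_zero
    have exactS : S.ShortExact := ModuleCat.shortComplex_shortExact S
      (LinearMap.exact_map_mkQ_range _) (IsFractionRing.injective A K) (Submodule.mkQ_surjective _)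
    have hI : CategoryTheory.Injective S.X₂ := Module.injective_object_of_injective_module A K
    -- The bound is weakened by one so that the dimension shift gives `d` for `K / A`, with no
    -- separate case `d = 0`.
    have h2 : HasInjectiveDimensionLT S.X₁ (d + 2) := by
      have : HasInjectiveDimensionLT S.X₁ (d + 1) := h
      exact hasInjectiveDimensionLT_of_ge _ (d + 1) _ (by omega)
    have h3 : HasInjectiveDimensionLE S.X₃ d := (exactS.hasInjectiveDimensionLT_X₃_iff d hI).2 h2
    refine Module.injective_of_hasInjectiveDimensionLE
      (fun p hp => or_iff_not_imp_right.2 (hmax p hp)) (y := y)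
      (Or.inr (mem_nonZeroDivisors_of_ne_zero hx0)) hy hmy d S.X₃ (Or.inr fun c => ?_) h3
    obtain ⟨c, rfl⟩ := N.mkQ_surjective c
    exact ⟨N.mkQ (c / algebraMap A K x), by
      rw [← map_smul, Algebra.smul_def, mul_div_cancel₀ _ hx0']⟩
  obtain ⟨f, hf⟩ := hKA.exists_end_apply_eq (s := N.mkQ s) (s' := N.mkQ s')
    (by simpa [N] using hs)
    (fun r hr => by
      rw [← map_smul, Submodule.mkQ_apply, Submodule.Quotient.mk_eq_zero]; exact hms r hr)
    (fun r hr => by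
      rw [← map_smul, Submodule.mkQ_apply, Submodule.Quotient.mk_eq_zero]; exact hms' r hr)
  -- The endomorphism `f` of `K / A` acts on `s = a / x` as a scalar: `f (1 / x)` is killed by `x`,
  -- hence is the class of some `b' / x`, so `f s` is the class of `b' • s`.
  obtain ⟨a, ha⟩ := hms x hxm
  obtain ⟨b, hb⟩ := N.mkQ_surjective (f (N.mkQ (algebraMap A K x)⁻¹))
  have h1N : N.mkQ (1 : K) = 0 := (Submodule.Quotient.mk_eq_zero N).2 ⟨1, map_one (algebraMap A K)⟩
  obtain ⟨b', hb'⟩ : x • b ∈ N := by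
    rw [← Submodule.Quotient.mk_eq_zero, ← Submodule.mkQ_apply, map_smul, hb, ← map_smul,
      ← map_smul, Algebra.smul_def, mul_inv_cancel₀ hx0', h1N, map_zero]
  have hs' : s = a • (algebraMap A K x)⁻¹ := by
    rw [Algebra.smul_def, ha, Algebra.smul_def]; field_simp
  have hb'' : b = b' • (algebraMap A K x)⁻¹ := by
    rw [Algebra.smul_def]
    have : algebraMap A K b' = x • b := hb'
    rw [this, Algebra.smul_def]; field_simp
  refine ⟨b', (hN _).1 ?_⟩
  rw [← Submodule.Quotient.mk_eq_zero, ← Submodule.mkQ_apply, map_sub, sub_eq_zero, ← hf]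
  conv_lhs => rw [hs', map_smul, map_smul, ← hb, hb'', ← map_smul, smul_comm, ← hs']

end Homological

/-! ### Artinian local rings with simple socle -/

/-- If `s` lies in every nonzero principal ideal of the local ring `R`, then any two elements of
the dual of a simple module are proportional. -/
theorem IsSimpleModule.exists_smul_eq_of_socle {R : Type u} [CommRing R] [IsLocalRing R] {s : R} (hs0 : s ≠ 0)
    (hs : ∀ f : R, f ≠ 0 → ∃ r, r * f = s)
    {M : Type*} [AddCommGroup M] [Module R M] [IsSimpleModule R M] {φ : M →ₗ[R] R} (hφ : φ ≠ 0)
    (ψ : M →ₗ[R] R) : ∃ r : R, r • φ = ψ := by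
  obtain ⟨v, hv⟩ : ∃ v, φ v ≠ 0 := by
    by_contra! h
    exact hφ (LinearMap.ext h)
  have hv0 : v ≠ 0 := fun h => hv (by rw [h, map_zero])
  have hspan : Submodule.span R {v} = ⊤ := IsSimpleModule.span_singleton_eq_top R hv0
  have hgen (χ χ' : M →ₗ[R] R) (h : χ v = χ' v) : χ = χ' :=
    LinearMap.ext_on hspan (by simpa using h)
  by_cases hψ : ψ v = 0
  · exact ⟨0, hgen _ _ (by simp [hψ])⟩
  obtain ⟨r₁, h₁⟩ := hs _ hv
  obtain ⟨r₂, h₂⟩ := hs _ hψ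
  -- Here `r₁ * φ v = s = r₂ * ψ v`. A non-unit `r₂` kills the simple module, which would make `s`
  -- zero.
  by_cases hr : IsUnit r₂
  · obtain ⟨u, rfl⟩ := hr
    refine ⟨(↑u⁻¹ : R) * r₁, hgen _ _ ?_⟩
    rw [LinearMap.smul_apply, smul_eq_mul, mul_assoc, h₁, ← h₂, ← mul_assoc, Units.inv_mul, one_mul]
  · have hkill : r₂ • v = 0 := by
      by_contra hne
      have : v ∈ Submodule.span R {r₂ • v} := by
        rw [IsSimpleModule.span_singleton_eq_top R hne]; trivial
      obtain ⟨t, ht⟩ := Submodule.mem_span_singleton.1 this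
      have hu : IsUnit (1 - t * r₂) := by
        refine (IsLocalRing.isUnit_or_isUnit_one_sub_self (t * r₂)).resolve_left fun h => hr ?_
        exact isUnit_of_mul_isUnit_right h
      have h0 : (1 - t * r₂) • v = 0 := by
        rw [sub_smul, one_smul, mul_smul, ht, sub_self]
      exact hv0 ((IsUnit.smul_eq_zero hu).1 h0)
    exact absurd (show s = 0 by rw [← h₂, ← smul_eq_mul, ← map_smul, hkill, map_zero]) hs0

theorem Module.length_dual_le_one_of_isSimpleModule {R : Type u} [CommRing R] [IsLocalRing R]
    {s : R} (hs0 : s ≠ 0) (hs : ∀ f : R, f ≠ 0 → ∃ r, r * f = s)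
    (M : Type*) [AddCommGroup M] [Module R M] [IsSimpleModule R M] :
    Module.length R (M →ₗ[R] R) ≤ 1 := by
  by_cases h : Subsingleton (M →ₗ[R] R)
  · simp
  · rw [not_subsingleton_iff_nontrivial] at h
    have : IsSimpleModule R (M →ₗ[R] R) := by
      rw [isSimpleModule_iff_toSpanSingleton_surjective]
      exact ⟨h, fun φ hφ ψ => IsSimpleModule.exists_smul_eq_of_socle hs0 hs hφ ψ⟩
    exact (Module.length_eq_one R _).le

/-- Dualizing is left exact, so along a composition series each simple factor contributes at most
one to the length of the dual. -/
theorem Module.length_dual_le {R : Type u} [CommRing R] [IsLocalRing R]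
    {s : R} (hs0 : s ≠ 0) (hs : ∀ f : R, f ≠ 0 → ∃ r, r * f = s)
    {M : Type*} [AddCommGroup M] [Module R M] (hM : IsFiniteLength R M) :
    Module.length R (M →ₗ[R] R) ≤ Module.length R M := by
  induction hM with
  | of_subsingleton => simp
  | @of_simple_quotient M _ _ N _ _ ih =>
    let ρ : (M →ₗ[R] R) →ₗ[R] (N →ₗ[R] R) := LinearMap.lcomp R R N.subtype
    let ρr : (M →ₗ[R] R) →ₗ[R] LinearMap.range ρ := ρ.rangeRestrict
    let κ : ((M ⧸ N) →ₗ[R] R) →ₗ[R] (M →ₗ[R] R) := LinearMap.lcomp R R N.mkQ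
    have hκ : Function.Injective κ := fun a b h => Submodule.linearMap_qext _ h
    have hex : Function.Exact κ ρr := by
      intro f
      constructor
      · intro h
        have h' : f ∘ₗ N.subtype = 0 := congrArg Subtype.val h
        refine ⟨N.liftQ f fun x hx => LinearMap.congr_fun h' ⟨x, hx⟩, ?_⟩
        ext x; rfl
      · rintro ⟨g, rfl⟩
        refine Subtype.ext (LinearMap.ext fun x => ?_)
        change g (N.mkQ x) = 0
        rw [Submodule.mkQ_apply, (Submodule.Quotient.mk_eq_zero N).2 x.2, map_zero]
    have e1 : Module.length R (M →ₗ[R] R) =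
        Module.length R ((M ⧸ N) →ₗ[R] R) + Module.length R (LinearMap.range ρ) :=
      Module.length_eq_add_of_exact κ ρr hκ ρ.surjective_rangeRestrict hex
    rw [e1,
      Module.length_eq_add_of_exact N.subtype N.mkQ N.subtype_injective N.mkQ_surjective
        (LinearMap.exact_subtype_mkQ N), Module.length_eq_one R (M ⧸ N), add_comm]
    exact add_le_add
      ((Module.length_le_of_injective _ (Submodule.subtype_injective _)).trans ih)
      (Module.length_dual_le_one_of_isSimpleModule hs0 hs _)

/-- An Artinian local ring with simple socle is self-injective. -/
theorem IsArtinianRing.injective_self_of_socle {R : Type u} [CommRing R] [IsLocalRing R]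
    [IsArtinianRing R] {s : R} (hs0 : s ≠ 0) (hs : ∀ f : R, f ≠ 0 → ∃ r, r * f = s) :
    Module.Injective R R := by
  rw [← Module.Baer.iff_injective, Module.Baer.iff_surjective]
  intro I
  let ρ : (R →ₗ[R] R) →ₗ[R] (I →ₗ[R] R) := LinearMap.lcomp R R I.subtype
  change Function.Surjective ρ
  let ρr : (R →ₗ[R] R) →ₗ[R] LinearMap.range ρ := ρ.rangeRestrict
  let κ : ((R ⧸ I) →ₗ[R] R) →ₗ[R] (R →ₗ[R] R) := LinearMap.lcomp R R I.mkQ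
  have hκ : Function.Injective κ := fun a b h => Submodule.linearMap_qext _ h
  have hex : Function.Exact κ ρr := by
    intro f
    constructor
    · intro h
      have h' : f ∘ₗ I.subtype = 0 := congrArg Subtype.val h
      refine ⟨I.liftQ f fun x hx => LinearMap.congr_fun h' ⟨x, hx⟩, ?_⟩
      ext; rfl
    · rintro ⟨g, rfl⟩
      refine Subtype.ext (LinearMap.ext fun x => ?_)
      change g (I.mkQ x) = 0
      rw [Submodule.mkQ_apply, (Submodule.Quotient.mk_eq_zero I).2 x.2, map_zero]
  have e1 : Module.length R (R →ₗ[R] R) =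
      Module.length R ((R ⧸ I) →ₗ[R] R) + Module.length R (LinearMap.range ρ) :=
    Module.length_eq_add_of_exact κ ρr hκ ρ.surjective_rangeRestrict hex
  have e2 := Module.length_eq_add_of_exact I.subtype I.mkQ I.subtype_injective I.mkQ_surjective
    (LinearMap.exact_subtype_mkQ I)
  rw [(LinearMap.ringLmapEquivSelf R R R).length_eq, e2] at e1
  have h1 : Module.length R ((R ⧸ I) →ₗ[R] R) ≤ Module.length R (R ⧸ I) :=
    Module.length_dual_le hs0 hs (isFiniteLength_iff_isNoetherian_isArtinian.2 ⟨inferInstance, inferInstance⟩)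
  have h2 : Module.length R (I →ₗ[R] R) ≤ Module.length R I :=
    Module.length_dual_le hs0 hs (isFiniteLength_iff_isNoetherian_isArtinian.2 ⟨inferInstance, inferInstance⟩)
  have t1 : Module.length R (R ⧸ I) ≠ ⊤ := Module.length_ne_top
  have t2 : Module.length R I ≠ ⊤ := Module.length_ne_top
  -- The dual of `R ⧸ I` is no longer than `R ⧸ I`, so the image of restriction has length at least
  -- that of `I`, which bounds the length of the dual of `I`. Hence restriction is onto.
  have hlen : Module.length R (I →ₗ[R] R) ≤ Module.length R (LinearMap.range ρ) := by
    refine h2.trans ?_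
    have : Module.length R I + Module.length R (R ⧸ I) ≤
        Module.length R (LinearMap.range ρ) + Module.length R (R ⧸ I) := by
      rw [e1, add_comm]; gcongr
    exact (ENat.add_le_add_iff_right t1).1 this
  have hfin : IsFiniteLength R (I →ₗ[R] R) :=
    Module.length_ne_top_iff.1 (ne_top_of_le_ne_top t2 h2)
  obtain ⟨_, _⟩ := isFiniteLength_iff_isNoetherian_isArtinian.1 hfin
  rw [← LinearMap.range_eq_top]
  by_contra hne
  exact absurd hlen (not_le.2 (Submodule.length_lt hne))

/-! ### Lengths and the Krull–Akizuki theorem -/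

open Submodule in
/-- Comparison of the lengths of `M / x M` and `A / x A` when `M / A` has finite length. -/
theorem Module.length_quotient_range_lsmul_le {A : Type*} [CommRing A] {M : Type*} [AddCommGroup M]
    [Module A M] {x : A} (hx : Function.Injective (LinearMap.lsmul A M x)) {i : A →ₗ[A] M}
    (hi : Function.Injective i) (hlen : Module.length A (M ⧸ LinearMap.range i) ≠ ⊤) :
    Module.length A (M ⧸ LinearMap.range (LinearMap.lsmul A M x)) ≤
      Module.length A (A ⧸ Ideal.span {x}) := by
  let μ := LinearMap.lsmul A M x
  let N := LinearMap.range i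
  let xN : Submodule A M := N.map μ
  have h1 : xN ≤ LinearMap.range μ := LinearMap.map_le_range
  have h2 : xN ≤ N := by
    rintro _ ⟨n, hn, rfl⟩
    exact N.smul_mem x hn
  have h3 : Ideal.span {x} ≤ xN.comap i := by
    rw [Ideal.span_singleton_le_iff_mem]
    exact ⟨i 1, ⟨1, rfl⟩, by simp [μ, ← map_smul]⟩
  -- The length of `M / xN` is computed through `xM` and through `N`. Multiplication by `x`
  -- identifies `M / N` with `xM / xN`, and this finite length cancels, leaving `M / xM` against `N
  -- / xN ≅ A / xA`.
  let f₁ : (M ⧸ N) →ₗ[A] M ⧸ xN := N.mapQ xN μ (le_comap_map _ _)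
  let g₁ : (M ⧸ xN) →ₗ[A] M ⧸ LinearMap.range μ := factor h1
  let f₂ : (A ⧸ Ideal.span {x}) →ₗ[A] M ⧸ xN := mapQ _ xN i h3
  let g₂ : (M ⧸ xN) →ₗ[A] M ⧸ N := factor h2
  have hf₁ : Function.Injective f₁ := by
    rw [injective_iff_map_eq_zero]
    intro a ha
    obtain ⟨a, rfl⟩ := N.mkQ_surjective a
    have : μ a ∈ xN := (Submodule.Quotient.mk_eq_zero _).1 ha
    obtain ⟨b, hb, hab⟩ := this
    rw [← hx hab]
    exact (Submodule.Quotient.mk_eq_zero _).2 hb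
  have hg₁ : Function.Surjective g₁ := factor_surjective h1
  have hg₂ : Function.Surjective g₂ := factor_surjective h2
  have hex₁ : Function.Exact f₁ g₁ := by
    intro a
    obtain ⟨a, rfl⟩ := xN.mkQ_surjective a
    constructor
    · intro h
      obtain ⟨b, hb⟩ : a ∈ LinearMap.range μ := (Submodule.Quotient.mk_eq_zero _).1 h
      exact ⟨N.mkQ b, congrArg xN.mkQ hb⟩
    · rintro ⟨b, hb⟩
      obtain ⟨b, rfl⟩ := N.mkQ_surjective b
      rw [← hb]
      exact (Submodule.Quotient.mk_eq_zero _).2 ⟨b, rfl⟩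
  have hf₂ : Function.Injective f₂ := by
    rw [injective_iff_map_eq_zero]
    intro a ha
    obtain ⟨a, rfl⟩ := mkQ_surjective _ a
    have : i a ∈ xN := (Submodule.Quotient.mk_eq_zero _).1 ha
    obtain ⟨_, ⟨b, rfl⟩, hab⟩ := this
    have : x * b = a := hi (by simpa [μ, ← map_smul] using hab)
    refine (Submodule.Quotient.mk_eq_zero _).2 ?_
    rw [← this]
    exact Ideal.mul_mem_right _ _ (Ideal.mem_span_singleton_self x)
  have hex₂ : Function.Exact f₂ g₂ := by
    intro a
    obtain ⟨a, rfl⟩ := xN.mkQ_surjective a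
    constructor
    · intro h
      obtain ⟨b, hb⟩ : a ∈ N := (Submodule.Quotient.mk_eq_zero _).1 h
      exact ⟨mkQ _ b, congrArg xN.mkQ hb⟩
    · rintro ⟨b, hb⟩
      obtain ⟨b, rfl⟩ := mkQ_surjective _ b
      rw [← hb]
      exact (Submodule.Quotient.mk_eq_zero _).2 ⟨b, rfl⟩
  have e1 := Module.length_eq_add_of_exact f₁ g₁ hf₁ hg₁ hex₁
  have e2 := Module.length_eq_add_of_exact f₂ g₂ hf₂ hg₂ hex₂
  rw [e1, add_comm] at e2
  exact (WithTop.add_right_cancel hlen e2).le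

/-- In a prime filtration torsion rules out the factor `A` itself, so every factor is simple. -/
theorem Ring.DimensionLEOne.length_ne_top_of_torsion {A : Type u} [CommRing A] [IsDomain A]
    [IsNoetherianRing A] [Ring.DimensionLEOne A] (M : Type u) [AddCommGroup M] [Module A M]
    [hM : Module.Finite A M] :
    (∀ m : M, ∃ a : A, a ≠ 0 ∧ a • m = 0) → Module.length A M ≠ ⊤ := by
  induction hM using IsNoetherianRing.induction_on_isQuotientEquivQuotientPrime A with
  | subsingleton N => simp
  | quotient N p e =>
    intro h
    obtain ⟨a, ha, hm⟩ := h (e.symm (Submodule.Quotient.mk 1))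
    rw [← map_smul, EmbeddingLike.map_eq_zero_iff, ← Submodule.Quotient.mk_smul, smul_eq_mul,
      mul_one, Submodule.Quotient.mk_eq_zero] at hm
    have hp0 : p.1 ≠ ⊥ := fun h0 => ha (by simpa [h0] using hm)
    have hpm : p.1.IsMaximal := Ring.DimensionLEOne.maximalOfPrime hp0 p.2
    have : IsSimpleModule A (A ⧸ p.1) :=
      isSimpleModule_iff_isCoatom.2 (Ideal.isMaximal_def.1 hpm)
    rw [e.length_eq, Module.length_eq_one]
    simp
  | exact N₁ N₂ N₃ f g hf hg hex h₁ h₃ =>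
    intro h
    rw [Module.length_eq_add_of_exact f g hf hg hex]
    refine WithTop.add_ne_top.2 ⟨h₁ fun m => ?_, h₃ fun m => ?_⟩
    · obtain ⟨a, ha, hm⟩ := h (f m)
      exact ⟨a, ha, hf (by rw [map_smul, hm, map_zero])⟩
    · obtain ⟨m, rfl⟩ := hg m
      obtain ⟨a, ha, hm⟩ := h m
      exact ⟨a, ha, by rw [← map_smul, hm, map_zero]⟩

theorem Module.Finite.of_forall_fg_length_le {A : Type*} [CommRing A] {W : Type*} [AddCommGroup W]
    [Module A W] {L : ℕ∞} (hL : L ≠ ⊤)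
    (h : ∀ S : Submodule A W, S.FG → Module.length A S ≤ L) : Module.Finite A W := by
  by_contra hW
  have key (n : ℕ) : ∃ S : Submodule A W, S.FG ∧ (n : ℕ∞) ≤ Module.length A S := by
    induction n with
    | zero => exact ⟨⊥, Submodule.fg_bot, by simp⟩
    | succ n ih =>
      obtain ⟨S, hS, hn⟩ := ih
      have hne : S ≠ ⊤ := fun hS' => hW ⟨hS' ▸ hS⟩
      obtain ⟨v, hv⟩ : ∃ v, v ∉ S := by
        by_contra! hc
        exact hne ((Submodule.eq_top_iff').2 hc)
      refine ⟨S ⊔ Submodule.span A {v}, hS.sup (Submodule.fg_span_singleton v), ?_⟩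
      have hlt : S < S ⊔ Submodule.span A {v} := by
        refine lt_of_le_of_ne le_sup_left fun he => hv ?_
        rw [he]
        exact Submodule.mem_sup_right (Submodule.mem_span_singleton_self v)
      have hfin := (h S hS).trans_lt hL.lt_top
      rw [Module.length_submodule] at hn hfin ⊢
      have := Order.height_strictMono hlt hfin
      push_cast
      exact (add_le_add_left hn 1).trans (Order.add_one_le_of_lt this)
  obtain ⟨n, rfl⟩ := ENat.ne_top_iff_exists.1 hL
  obtain ⟨S, hS, hn⟩ := key (n + 1)
  have := hn.trans (h S hS)
  norm_cast at this
  omega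

section KrullAkizuki

variable {A : Type u} [CommRing A] [IsDomain A] [IsNoetherianRing A] [Ring.DimensionLEOne A]
  {V : Type u} [CommRing V] [IsDomain V] [Algebra A V] [FaithfulSMul A V]
  (hV : ∀ v : V, ∃ a b : A, a ≠ 0 ∧ a • v = algebraMap A V b)

-- A finitely generated submodule of `V / xV` lies in the image of `M / xM` for a finite `A`-module
-- `M` with `1 ∈ M ⊆ V`. Its length is thus at most that of `A / xA`, and a uniform bound on lengths
-- forces finiteness.
include hV in
theorem Module.Finite.quotient_span_singleton_of_birational {x : A} (hx : x ≠ 0) :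
    Module.Finite A (V ⧸ Ideal.span {algebraMap A V x}) := by
  have : Ring.KrullDimLE 1 A := inferInstance
  refine Module.Finite.of_forall_fg_length_le (L := Module.length A (A ⧸ Ideal.span {x})) ?_ ?_
  · exact Module.length_ne_top_iff.2 (_root_.isFiniteLength_quotient_span_singleton A
      (mem_nonZeroDivisors_of_ne_zero hx))
  intro S hS
  obtain ⟨T, rfl⟩ := hS
  obtain ⟨σ, hσ⟩ := (Ideal.Quotient.mk_surjective (I := Ideal.span {algebraMap A V x})).hasRightInverse
  let M : Submodule A V := Submodule.span A (insert 1 (σ '' T))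
  have : Module.Finite A M :=
    Module.Finite.span_of_finite A ((T.finite_toSet.image σ).insert 1)
  have h1M : (1 : V) ∈ M := Submodule.subset_span (Set.mem_insert _ _)
  let i : A →ₗ[A] M := LinearMap.toSpanSingleton A M ⟨1, h1M⟩
  have hi_apply (a : A) : (i a : V) = algebraMap A V a := by
    simp [i, Algebra.algebraMap_eq_smul_one]
  have hi : Function.Injective i := fun a b hab => FaithfulSMul.algebraMap_injective A V (by
    rw [← hi_apply, ← hi_apply, hab])
  have hx' : algebraMap A V x ≠ 0 := by
    rwa [Ne, FaithfulSMul.algebraMap_eq_zero_iff]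
  have hμ : Function.Injective (LinearMap.lsmul A M x) := by
    intro a b hab
    have : x • (a : V) = x • (b : V) := congrArg Subtype.val hab
    rw [Algebra.smul_def, Algebra.smul_def] at this
    exact Subtype.ext (mul_left_cancel₀ hx' this)
  have hlen : Module.length A (M ⧸ LinearMap.range i) ≠ ⊤ := by
    refine Ring.DimensionLEOne.length_ne_top_of_torsion _ fun m => ?_
    obtain ⟨m, rfl⟩ := Submodule.mkQ_surjective _ m
    obtain ⟨a, b, ha, hab⟩ := hV m
    refine ⟨a, ha, ?_⟩
    rw [← map_smul]
    exact (Submodule.Quotient.mk_eq_zero _).2 ⟨b, Subtype.ext (by rw [hi_apply, ← hab]; rfl)⟩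
  refine le_trans ?_ (Module.length_quotient_range_lsmul_le hμ hi hlen)
  let φ : M →ₗ[A] V ⧸ Ideal.span {algebraMap A V x} :=
    (Ideal.Quotient.mkₐ A (Ideal.span {algebraMap A V x})).toLinearMap ∘ₗ M.subtype
  have hφ : LinearMap.range (LinearMap.lsmul A M x) ≤ LinearMap.ker φ := by
    rintro _ ⟨m, rfl⟩
    rw [LinearMap.mem_ker]
    refine Ideal.Quotient.eq_zero_iff_mem.2 ?_
    change x • (m : V) ∈ _
    rw [Algebra.smul_def]
    exact Ideal.mul_mem_right _ _ (Ideal.mem_span_singleton_self _)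
  let ψ := Submodule.liftQ _ φ hφ
  have hS : Submodule.span A (T : Set (V ⧸ Ideal.span {algebraMap A V x})) ≤ LinearMap.range ψ := by
    rw [Submodule.span_le]
    intro t ht
    exact ⟨Submodule.Quotient.mk ⟨σ t, Submodule.subset_span
      (Set.mem_insert_of_mem _ ⟨t, ht, rfl⟩)⟩, hσ t⟩
  exact (Module.length_le_of_injective _ (Submodule.inclusion_injective hS)).trans
    (Module.length_le_of_surjective ψ.rangeRestrict ψ.surjective_rangeRestrict)

omit [IsDomain A] [IsNoetherianRing A] [Ring.DimensionLEOne A] in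
include hV in
theorem exists_algebraMap_mem_of_birational {J : Ideal V} (hJ : J ≠ ⊥) :
    ∃ x : A, x ≠ 0 ∧ algebraMap A V x ∈ J := by
  obtain ⟨v, hv, hv0⟩ := Submodule.exists_mem_ne_zero_of_ne_bot hJ
  obtain ⟨a, b, ha, hab⟩ := hV v
  refine ⟨b, ?_, ?_⟩
  · rintro rfl
    rw [map_zero, Algebra.smul_def, mul_eq_zero, FaithfulSMul.algebraMap_eq_zero_iff] at hab
    exact hab.elim ha hv0
  · rw [← hab, Algebra.smul_def]
    exact J.mul_mem_left _ hv

include hV in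
theorem IsNoetherianRing.of_birational : IsNoetherianRing V := by
  refine ⟨fun J => ?_⟩
  by_cases hJ : J = ⊥
  · exact hJ ▸ Submodule.fg_bot
  obtain ⟨x, hx, hxJ⟩ := exists_algebraMap_mem_of_birational hV hJ
  have := Module.Finite.quotient_span_singleton_of_birational hV hx
  have : IsNoetherian V (V ⧸ Ideal.span {algebraMap A V x}) :=
    isNoetherian_of_tower A inferInstance
  refine Submodule.fg_of_fg_map_of_fg_inf_ker (Submodule.mkQ (Ideal.span {algebraMap A V x}))
    (IsNoetherian.noetherian _) ?_
  rw [Submodule.ker_mkQ, inf_eq_right.2 ((Ideal.span_singleton_le_iff_mem _).2 hxJ)]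
  exact Submodule.fg_span_singleton _

end KrullAkizuki

/-! ### The normalization of a complete one-dimensional domain -/

open TensorProduct in
theorem IsPrecomplete.of_finite {A : Type*} [CommRing A] (I : Ideal A) [IsPrecomplete I A]
    (M : Type*) [AddCommGroup M] [Module A M] [Module.Finite A M] : IsPrecomplete I M := by
  rw [← AdicCompletion.of_surjective_iff]
  intro y
  obtain ⟨t, rfl⟩ := AdicCompletion.ofTensorProduct_surjective_of_finite I M y
  induction t with
  | zero => exact ⟨0, by simp⟩
  | add a b ha hb =>
    obtain ⟨a', ha⟩ := ha
    obtain ⟨b', hb⟩ := hb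
    exact ⟨a' + b', by rw [map_add, map_add, ha, hb]⟩
  | tmul r m =>
    obtain ⟨r, rfl⟩ := AdicCompletion.of_surjective I A r
    refine ⟨r • m, ?_⟩
    rw [AdicCompletion.ofTensorProduct_tmul, map_smul]
    ext n
    simp [AdicCompletion.smul_eval]
    rfl

/-- A Hausdorff module over a complete ring which is finite modulo `I` is finite. -/
theorem Module.Finite.of_isHausdorff {A : Type*} [CommRing A] (I : Ideal A) [IsPrecomplete I A]
    (M : Type*) [AddCommGroup M] [Module A M] [IsHausdorff I M]
    [h : Module.Finite A (M ⧸ (I • ⊤ : Submodule A M))] : Module.Finite A M := by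
  obtain ⟨T, hT⟩ := h.fg_top
  obtain ⟨σ, hσ⟩ := ((I • ⊤ : Submodule A M).mkQ_surjective).hasRightInverse
  let S : Submodule A M := Submodule.span A (σ '' T)
  have : Module.Finite A S := Module.Finite.span_of_finite A (T.finite_toSet.image σ)
  have := IsPrecomplete.of_finite I S
  have hsurj : Function.Surjective S.subtype := by
    refine surjective_of_mkQ_comp_surjective (I := I) ?_
    rw [← LinearMap.range_eq_top, eq_top_iff, ← hT, Submodule.span_le]
    intro t ht
    exact ⟨⟨σ t, Submodule.subset_span ⟨t, ht, rfl⟩⟩, hσ t⟩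
  exact Module.Finite.of_surjective S.subtype hsurj

open Polynomial in
/-- A Dedekind domain complete along a nonzero ideal is local. -/
theorem IsDedekindDomain.isLocalRing_of_henselianRing {V : Type*} [CommRing V] [IsDedekindDomain V]
    (I : Ideal V) [HenselianRing V I] (hI0 : I ≠ ⊥) : IsLocalRing V := by
  have hI (P : Ideal V) (hP : P.IsMaximal) : I ≤ P :=
    (HenselianRing.jac (R := V) (I := I)).trans (sInf_le ⟨bot_le, hP⟩)
  obtain ⟨P, hP⟩ := Ideal.exists_maximal V
  refine IsLocalRing.of_unique_max_ideal ⟨P, hP, fun Q hQ => ?_⟩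
  by_contra hne
  have hQ' : Q.IsMaximal := hQ
  have hPQ : ¬ P ≤ Q := fun h => hne (hP.eq_of_le hQ'.ne_top h).symm
  -- With two maximal ideals, `I = P ^ a * J` with `P` and `J` coprime. This yields an idempotent
  -- modulo `I`; Hensel's lemma for `X ^ 2 - X` lifts it to `0` or `1`, which is impossible.
  obtain ⟨J, hJ, hPJ⟩ := (FiniteMultiplicity.of_not_isUnit (a := P) (b := I)
    (by rw [Ideal.isUnit_iff]; exact hP.ne_top) hI0).exists_eq_pow_mul_and_not_dvd
  set a := multiplicity P I
  have ha : a ≠ 0 := by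
    intro ha
    rw [ha, pow_zero, one_mul] at hJ
    exact hPJ (hJ ▸ Ideal.dvd_iff_le.2 (hI P hP))
  have hJQ : J ≤ Q := by
    have := hI Q hQ'
    rw [hJ] at this
    exact (hQ'.isPrime.mul_le.1 this).resolve_left fun h => hPQ (hQ'.isPrime.le_of_pow_le h)
  have hcop : IsCoprime P J := by
    rw [Ideal.isCoprime_iff_sup_eq]
    refine hP.1.2 _ (lt_of_le_of_ne le_sup_left fun h => hPJ (Ideal.dvd_iff_le.2 ?_))
    rw [h]; exact le_sup_right
  obtain ⟨e, he, f, hf, hef⟩ := Ideal.isCoprime_iff_exists.1 (hcop.pow_left (m := a))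
  have hfe : f = 1 - e := by rw [← hef]; ring
  have heP : e ∈ P := Ideal.pow_le_self ha he
  have heI : e * (1 - e) ∈ I := by
    rw [hJ, ← hfe]; exact Ideal.mul_mem_mul he hf
  obtain ⟨b, hb, hbe⟩ := HenselianRing.is_henselian (I := I) (X ^ 2 - X : V[X])
    (by monicity!) e (by
      simp only [eval_sub, eval_pow, eval_X]
      convert I.neg_mem heI using 1
      ring) (by
      simp only [derivative_sub, derivative_X_pow, derivative_X, eval_sub, eval_mul, eval_one,
        eval_X, Nat.cast_ofNat, Nat.add_one_sub_one, pow_one, eval_C]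
      -- The derivative is its own inverse modulo `I`, since `(2e - 1)² - 1 = -4 e (1 - e)`.
      refine IsUnit.of_mul_eq_one (Ideal.Quotient.mk I (2 * e - 1)) ?_
      rw [← map_mul, ← map_one (Ideal.Quotient.mk I), Ideal.Quotient.eq]
      convert I.mul_mem_left (-4) heI using 1
      ring)
  have hb' : b * (b - 1) = 0 := by
    have : b ^ 2 - b = 0 := by simpa [IsRoot] using hb
    linear_combination this
  rcases mul_eq_zero.1 hb' with rfl | hb1
  · have : e ∈ Q := hI Q hQ' (by simpa using hbe)
    exact hQ'.ne_top ((Ideal.eq_top_iff_one _).2 (hef ▸ Q.add_mem this (hJQ hf)))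
  · rw [sub_eq_zero] at hb1
    have : f ∈ P := hI P hP (by rw [hfe, ← hb1]; exact hbe)
    exact hP.ne_top ((Ideal.eq_top_iff_one _).2 (hef ▸ P.add_mem heP this))

/-- The residue field `V ⧸ n` is integral over the algebraically closed residue field of `A`, so the
two coincide. -/
theorem Ideal.exists_sub_algebraMap_mem_of_isAlgClosed {A V : Type*} [CommRing A] [IsLocalRing A]
    [IsAlgClosed (IsLocalRing.ResidueField A)] [CommRing V] [Algebra A V]
    [Algebra.IsIntegral A V] (n : Ideal V) [hn : n.IsMaximal] (v : V) :
    ∃ a : A, v - algebraMap A V a ∈ n := by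
  have hm : IsLocalRing.maximalIdeal A = n.comap (algebraMap A V) :=
    (IsLocalRing.eq_maximalIdeal (Ideal.isMaximal_comap_of_isIntegral_of_isMaximal n)).symm
  let φ : IsLocalRing.ResidueField A →+* V ⧸ n := Ideal.quotientMap n (algebraMap A V) hm.le
  have hφ : φ.IsIntegral := by
    intro x
    obtain ⟨x, rfl⟩ := Ideal.Quotient.mk_surjective x
    obtain ⟨p, hp, hpx⟩ := Algebra.IsIntegral.isIntegral (R := A) x
    refine ⟨p.map (IsLocalRing.residue A), hp.map _, ?_⟩
    have hcomp : φ.comp (IsLocalRing.residue A) =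
        (Ideal.Quotient.mk n).comp (algebraMap A V) := RingHom.ext fun _ => rfl
    rw [Polynomial.eval₂_map, hcomp, ← Polynomial.hom_eval₂, hpx, map_zero]
  let _ : Field (V ⧸ n) := Ideal.Quotient.field n
  obtain ⟨a, ha⟩ := (IsAlgClosed.ringHom_bijective_of_isIntegral φ hφ).2 (Ideal.Quotient.mk n v)
  obtain ⟨a, rfl⟩ := Ideal.Quotient.mk_surjective a
  refine ⟨a, Ideal.Quotient.eq.1 ?_⟩
  rw [← ha]; rfl

section IntegralClosure

variable (A : Type u) [CommRing A] [IsDomain A] [IsNoetherianRing A] [Ring.DimensionLEOne A]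

omit [IsNoetherianRing A] [Ring.DimensionLEOne A] in
theorem integralClosure.exists_smul_eq_algebraMap (v : integralClosure A (FractionRing A)) :
    ∃ a b : A, a ≠ 0 ∧ a • v = algebraMap A _ b := by
  obtain ⟨⟨b, a⟩, h⟩ := IsLocalization.surj (nonZeroDivisors A) (v : FractionRing A)
  refine ⟨a, b, nonZeroDivisors.ne_zero a.2, Subtype.ext ?_⟩
  rw [Algebra.smul_def, mul_comm]
  exact h

theorem integralClosure.isDedekindDomain_of_dimensionLEOne :
    IsDedekindDomain (integralClosure A (FractionRing A)) := by
  have h1 : IsNoetherianRing (integralClosure A (FractionRing A)) :=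
    IsNoetherianRing.of_birational (integralClosure.exists_smul_eq_algebraMap A)
  have h2 : IsIntegrallyClosed (integralClosure A (FractionRing A)) :=
    integralClosure.isIntegrallyClosedOfFiniteExtension (FractionRing A)
  have h3 : Ring.DimensionLEOne (integralClosure A (FractionRing A)) := inferInstance
  exact {}

variable [IsLocalRing A] [IsAdicComplete (IsLocalRing.maximalIdeal A) A]

/-- By Krull–Akizuki `V` is Noetherian and `V / mV` is finite over `A`. Lying over gives `mV ≠ V`,
so `V` is `m`-adically separated by Krull's intersection theorem, and completeness of `A` lifts
generators of `V / mV`. -/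
theorem integralClosure.finite_of_isAdicComplete (hA : ¬ IsField A) :
    Module.Finite A (integralClosure A (FractionRing A)) := by
  let m := IsLocalRing.maximalIdeal A
  let V := integralClosure A (FractionRing A)
  obtain ⟨x, hxm, hx0⟩ := Submodule.exists_mem_ne_zero_of_ne_bot
    (mt IsLocalRing.isField_iff_maximalIdeal_eq.2 hA)
  have hnoeth : IsNoetherianRing V :=
    IsNoetherianRing.of_birational (integralClosure.exists_smul_eq_algebraMap A)
  have h1 := Module.Finite.quotient_span_singleton_of_birational
    (integralClosure.exists_smul_eq_algebraMap A) hx0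
  have hne : m.map (algebraMap A V) ≠ ⊤ := by
    obtain ⟨P, hP, hPm⟩ := Ideal.exists_ideal_over_maximal_of_isIntegral (S := V) m
      (by rw [(RingHom.injective_iff_ker_eq_bot _).1 (FaithfulSMul.algebraMap_injective A V)]
          exact bot_le)
    exact ne_top_of_le_ne_top hP.ne_top (Ideal.map_le_iff_le_comap.2 hPm.ge)
  have h2 : IsHausdorff (m.map (algebraMap A V)) V := IsHausdorff.of_isDomain _ hne
  have h3 : IsHausdorff m V := IsHausdorff.map_algebraMap_iff.1 h2
  have h4 : Module.Finite A (V ⧸ (m • ⊤ : Submodule A V)) := by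
    let f : (V ⧸ Ideal.span {algebraMap A V x}) →ₗ[A] V ⧸ (m • ⊤ : Submodule A V) :=
      ((Ideal.span {algebraMap A V x}).restrictScalars A).liftQ (m • ⊤ : Submodule A V).mkQ (by
        intro v hv
        obtain ⟨w, rfl⟩ := Ideal.mem_span_singleton'.1 hv
        rw [LinearMap.mem_ker, Submodule.mkQ_apply, Submodule.Quotient.mk_eq_zero, mul_comm,
          ← Algebra.smul_def]
        exact Submodule.smul_mem_smul hxm trivial)
    refine Module.Finite.of_surjective f fun y => ?_
    obtain ⟨y, rfl⟩ := Submodule.mkQ_surjective _ y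
    exact ⟨Submodule.Quotient.mk y, rfl⟩
  exact Module.Finite.of_isHausdorff m V

/-- Being finite over `A`, `V` is complete along the nonzero ideal `mV`, hence henselian there. -/
theorem integralClosure.isLocalRing_of_isAdicComplete (hA : ¬ IsField A) :
    IsLocalRing (integralClosure A (FractionRing A)) := by
  let m := IsLocalRing.maximalIdeal A
  let V := integralClosure A (FractionRing A)
  have hded : IsDedekindDomain V := integralClosure.isDedekindDomain_of_dimensionLEOne A
  have hfin : Module.Finite A V := integralClosure.finite_of_isAdicComplete A hA
  have h1 : IsPrecomplete m V := IsPrecomplete.of_finite m V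
  have h2 : IsAdicComplete m V := {}
  have h3 : IsAdicComplete (m.map (algebraMap A V)) V := (IsAdicComplete.map_algebraMap_iff _ _).2 h2
  refine IsDedekindDomain.isLocalRing_of_henselianRing (m.map (algebraMap A V)) ?_
  rw [Ne, Ideal.map_eq_bot_iff_of_injective (FaithfulSMul.algebraMap_injective A V)]
  exact mt IsLocalRing.isField_iff_maximalIdeal_eq.2 hA

end IntegralClosure

/-! ### The value semigroup and its symmetry -/

theorem adicOrder_eq_natCast_iff {V : Type u} [CommRing V] (n : Ideal V) (f : V) (h : ℕ) :
    adicOrder n f = h ↔ f ∈ n ^ h ∧ f ∉ n ^ (h + 1) := by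
  have hle (i : ℕ) (hi : f ∈ n ^ i) : (i : ℕ∞) ≤ adicOrder n f :=
    le_iSup₂_of_le (f := fun (i : ℕ) (_ : i ∈ {i : ℕ | f ∈ n ^ i}) => (i : ℕ∞)) i hi le_rfl
  constructor
  · intro e
    have h2 : f ∉ n ^ (h + 1) := by
      intro hf
      have := hle _ hf
      rw [e] at this
      norm_cast at this
      omega
    refine ⟨?_, h2⟩
    by_contra hf
    have hlt (i : ℕ) (hi : f ∈ n ^ i) : i + 1 ≤ h := by
      by_contra hc
      exact hf (Ideal.pow_le_pow_right (by omega) hi)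
    -- Membership in `n ^ 0` gives `1 ≤ h`, so `h - 1` below does not truncate.
    have h0 := hlt 0 (by simp)
    have : adicOrder n f ≤ ((h - 1 : ℕ) : ℕ∞) := by
      refine iSup₂_le fun i hi => ?_
      have := hlt i hi
      exact_mod_cast (by omega : i ≤ h - 1)
    rw [e] at this
    norm_cast at this
    omega
  · rintro ⟨h1, h2⟩
    refine le_antisymm (iSup₂_le fun i hi => ?_) (hle h h1)
    by_contra hc
    have hc' : h + 1 ≤ i := by
      rw [not_le] at hc
      exact_mod_cast hc
    exact h2 (Ideal.pow_le_pow_right hc' hi)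

theorem mem_valueSemigroup_iff {A : Type u} [CommRing A] {V : Type u} [CommRing V] [Algebra A V]
    {n : Ideal V} {h : ℕ} :
    h ∈ valueSemigroup A n ↔ ∃ a : A, algebraMap A V a ∈ n ^ h ∧ algebraMap A V a ∉ n ^ (h + 1) := by
  constructor
  · rintro ⟨f, -, hf⟩
    exact ⟨f, (adicOrder_eq_natCast_iff _ _ _).1 hf⟩
  · rintro ⟨f, hf⟩
    refine ⟨f, ?_, (adicOrder_eq_natCast_iff _ _ _).2 hf⟩
    rintro rfl
    exact hf.2 (by simp)

theorem semigroupConductor_spec {H : Set ℕ} (hH : ∃ c, ∀ m, c ≤ m → m ∈ H) :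
    ∀ m, semigroupConductor H ≤ m → m ∈ H :=
  Nat.sInf_mem (s := {c : ℕ | ∀ m : ℕ, c ≤ m → m ∈ H}) hH

theorem semigroupConductor_pred_notMem {H : Set ℕ} (hH : ∃ c, ∀ m, c ≤ m → m ∈ H) {k : ℕ}
    (hk : k + 1 = semigroupConductor H) : k ∉ H := by
  intro h
  have : semigroupConductor H ≤ k := by
    refine Nat.sInf_le fun m hm => ?_
    rcases hm.eq_or_lt with rfl | hlt
    · exact h
    · exact semigroupConductor_spec hH m (by omega)
  omega

/-- Symmetry of the value semigroup: if the socle of `V / A` is simple, then reflections of gaps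
are values. -/
theorem mem_valueSemigroup_of_notMem {A : Type u} [CommRing A] [IsLocalRing A] {V : Type u}
    [CommRing V] [Algebra A V] {n : Ideal V}
    (hone : ∀ (i : ℕ) (x y : V), x ∈ n ^ i → y ∈ n ^ i → y ∉ n ^ (i + 1) →
      ∃ a : A, x - algebraMap A V a * y ∈ n ^ (i + 1))
    (hadd : ∀ i j, i ∈ valueSemigroup A n → j ∈ valueSemigroup A n → i + j ∈ valueSemigroup A n)
    (hne : ∀ i, ∃ w ∈ n ^ i, w ∉ n ^ (i + 1))
    (hm : ∀ a ∈ IsLocalRing.maximalIdeal A, algebraMap A V a ∈ n)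
    (hsoc : ∀ s s' : V, s ∉ Set.range (algebraMap A V) →
      (∀ r ∈ IsLocalRing.maximalIdeal A, algebraMap A V r * s ∈ Set.range (algebraMap A V)) →
      (∀ r ∈ IsLocalRing.maximalIdeal A, algebraMap A V r * s' ∈ Set.range (algebraMap A V)) →
      ∃ r, s' - algebraMap A V r * s ∈ Set.range (algebraMap A V))
    {F : ℕ} (hc : ∀ x ∈ n ^ (F + 1), x ∈ Set.range (algebraMap A V))
    (hF : F ∉ valueSemigroup A n) {i : ℕ} (hi : i ≤ F) (hiH : i ∉ valueSemigroup A n) :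
    F - i ∈ valueSemigroup A n := by
  -- `B i` is the colon of `A ∩ n ^ i` into `A`, and `D i` is `A + n ^ (F + 1 - i)`. They are shown
  -- to coincide for `i ≤ F + 1`: `D ⊆ B` because `n ^ (F + 1) ⊆ A`, and `B ⊆ D` by induction using
  -- the simple socle.
  let B (i : ℕ) (z : V) : Prop :=
    ∀ a, algebraMap A V a ∈ n ^ i → z * algebraMap A V a ∈ Set.range (algebraMap A V)
  let D (i : ℕ) (z : V) : Prop := ∃ b, z - algebraMap A V b ∈ n ^ (F + 1 - i)
  have hanti {i j : ℕ} (h : i ≤ j) {x : V} (hx : x ∈ n ^ j) : x ∈ n ^ i :=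
    Ideal.pow_le_pow_right h hx
  have hDB {i : ℕ} (hi : i ≤ F + 1) {z : V} (hz : D i z) : B i z := by
    intro a ha
    obtain ⟨b, hb⟩ := hz
    have h1 : (z - algebraMap A V b) * algebraMap A V a ∈ n ^ (F + 1) := by
      have := Ideal.mul_mem_mul hb ha
      rwa [← pow_add, Nat.sub_add_cancel hi] at this
    obtain ⟨t, ht⟩ := hc _ h1
    exact ⟨t + b * a, by rw [map_add, ht, map_mul]; ring⟩
  -- An element of `A` congruent to `w` modulo `n ^ (F - k + 1)` would have order `F - k`.
  have hw {k : ℕ} (hk : k ≤ F) (hkH : F - k ∉ valueSemigroup A n) {w : V} (hw1 : w ∈ n ^ (F - k))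
      (hw2 : w ∉ n ^ (F - k + 1)) : ¬ D k w := by
    rintro ⟨b, hb⟩
    rw [Nat.succ_sub hk] at hb
    refine hkH (mem_valueSemigroup_iff.2 ⟨b, ?_, fun h => hw2 ?_⟩)
    · have := sub_mem hw1 (hanti (Nat.le_succ _) hb)
      rwa [sub_sub_cancel] at this
    · have := add_mem hb h
      rwa [sub_add_cancel] at this
  have hBpred {k : ℕ} (hkH : k ∉ valueSemigroup A n) {z : V} (hz : B (k + 1) z) : B k z := by
    intro a ha
    refine hz a ?_
    by_contra h
    exact hkH (mem_valueSemigroup_iff.2 ⟨a, ha, h⟩)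
  have hBD (k : ℕ) (hk : k ≤ F + 1) : ∀ z, B k z → D k z := by
    induction k with
    | zero =>
      intro z hz
      obtain ⟨b, hb⟩ := hz 1 (by simp)
      exact ⟨b, by rw [hb]; simp⟩
    | succ k ih =>
      have hk' : k ≤ F := by omega
      intro z hz
      by_cases hkH : k ∈ valueSemigroup A n
      · have hFk : F - k ∉ valueSemigroup A n := by
          intro h
          have := hadd _ _ h hkH
          rw [Nat.sub_add_cancel hk'] at this
          exact hF this
        obtain ⟨w, hw1, hw2⟩ := hne (F - k)
        have hwD : D (k + 1) w := ⟨0, by rw [map_zero, sub_zero, Nat.add_sub_add_right]; exact hw1⟩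
        have hwB := mt (ih (by omega) w) (hw hk' hFk hw1 hw2)
        obtain ⟨a, ha, hwa⟩ : ∃ a, algebraMap A V a ∈ n ^ k ∧
            w * algebraMap A V a ∉ Set.range (algebraMap A V) := by
          by_contra! h
          exact hwB h
        have ha' : algebraMap A V a ∉ n ^ (k + 1) := fun h => hwa (hDB hk hwD a h)
        have hkill {y : V} (hy : B (k + 1) y) (r : A) (hr : r ∈ IsLocalRing.maximalIdeal A) :
            algebraMap A V r * (y * algebraMap A V a) ∈ Set.range (algebraMap A V) := by
          have h1 : algebraMap A V (r * a) ∈ n ^ (k + 1) := by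
            rw [map_mul, pow_succ']
            exact Ideal.mul_mem_mul (hm r hr) ha
          obtain ⟨t, ht⟩ := hy _ h1
          exact ⟨t, by rw [ht, map_mul]; ring⟩
        -- Both `w * a` and `z * a` represent socle elements of `V / A`, the first nonzero.
        -- Correcting `z` by a multiple of `w` therefore puts it in `B k`, and `w` lies in `D (k +
        -- 1)`.
        obtain ⟨r, hr⟩ := hsoc _ (z * algebraMap A V a) hwa (hkill (hDB hk hwD)) (hkill hz)
        have hz' : B k (z - algebraMap A V r * w) := by
          intro a' ha''
          obtain ⟨t, ht⟩ := hone k _ _ ha'' ha ha'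
          rw [← map_mul, ← map_sub] at ht
          obtain ⟨u₁, hu₁⟩ := hz _ ht
          obtain ⟨u₂, hu₂⟩ := hDB hk hwD _ ht
          obtain ⟨u₃, hu₃⟩ := hr
          refine ⟨u₁ - r * u₂ + t * u₃, ?_⟩
          rw [map_add, map_sub, map_mul, map_mul, hu₁, hu₂, hu₃, map_sub, map_mul]
          ring
        obtain ⟨b, hb⟩ := ih (by omega) _ hz'
        refine ⟨b, ?_⟩
        rw [Nat.succ_sub hk'] at hb
        rw [Nat.add_sub_add_right]
        have := add_mem (hanti (Nat.le_succ _) hb) (Ideal.mul_mem_left _ (algebraMap A V r) hw1)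
        convert this using 1
        ring
      · obtain ⟨b, hb⟩ := ih (by omega) z (hBpred hkH hz)
        exact ⟨b, hanti (by omega) hb⟩
  by_contra hFi
  obtain ⟨w, hw1, hw2⟩ := hne (F - i)
  have hwD : D (i + 1) w := ⟨0, by rw [map_zero, sub_zero, Nat.add_sub_add_right]; exact hw1⟩
  -- At a gap `i`, `B (i + 1) = B i`. An element of order `F - i` lies in `D (i + 1)`, hence in `D
  -- i`, which is impossible if `F - i` is a gap as well.
  exact hw hi hFi hw1 hw2 (hBD i (by omega) w (hBpred hiH (hDB (by omega) hwD)))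

/-- A common denominator `a` of finitely many generators satisfies `aV ⊆ A`. As `n` is the only
possible nonzero prime of `V`, some power of it lies in `aV`. -/
theorem exists_pow_le_range_of_finite {A : Type u} [CommRing A] [IsDomain A] {V : Type u}
    [CommRing V] [IsDedekindDomain V] [IsLocalRing V] [Algebra A V] [FaithfulSMul A V]
    [hfin : Module.Finite A V] (hV : ∀ v : V, ∃ a b : A, a ≠ 0 ∧ a • v = algebraMap A V b)
    (n : Ideal V) [n.IsMaximal] :
    ∃ N, ∀ x ∈ n ^ N, x ∈ Set.range (algebraMap A V) := by
  choose α β hα hαβ using hV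
  obtain ⟨T, hT⟩ := hfin.fg_top
  let a := ∏ t ∈ T, α t
  have ha : a ≠ 0 := Finset.prod_ne_zero_iff.2 fun t _ => hα t
  have hav (v : V) : a • v ∈ LinearMap.range (Algebra.linearMap A V) := by
    have : v ∈ Submodule.span A (T : Set V) := by rw [hT]; trivial
    induction this using Submodule.span_induction with
    | mem t ht =>
      obtain ⟨b, hb⟩ := Finset.dvd_prod_of_mem α ht
      have e : a = b * α t := hb.trans (mul_comm _ _)
      rw [e, mul_smul, hαβ]
      exact Submodule.smul_mem _ _ ⟨_, rfl⟩
    | zero => simp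
    | add x y _ _ hx hy => rw [smul_add]; exact add_mem hx hy
    | smul r x _ hx => rw [smul_comm]; exact Submodule.smul_mem _ _ hx
  have hrad : n ≤ (Ideal.span {algebraMap A V a}).radical := by
    rw [Ideal.radical_eq_sInf]
    refine le_sInf fun P ⟨hP, hPp⟩ => ?_
    have hP0 : P ≠ ⊥ := by
      rintro rfl
      rw [Ideal.span_singleton_le_iff_mem, Ideal.mem_bot, FaithfulSMul.algebraMap_eq_zero_iff] at hP
      exact ha hP
    have hPm : P.IsMaximal := Ring.DimensionLEOne.maximalOfPrime hP0 hPp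
    rw [IsLocalRing.eq_maximalIdeal hPm, IsLocalRing.eq_maximalIdeal ‹n.IsMaximal›]
  obtain ⟨N, hN⟩ := Ideal.exists_pow_le_of_le_radical_of_fg hrad (IsNoetherian.noetherian n)
  refine ⟨N, fun x hx => ?_⟩
  obtain ⟨v, rfl⟩ := Ideal.mem_span_singleton'.1 (hN hx)
  obtain ⟨b, hb⟩ := hav v
  exact ⟨b, by rw [mul_comm, ← Algebra.smul_def, ← hb]; rfl⟩

/-- Beyond `c` every leading term is that of an element of `A`; subtracting such elements raises the
order until it reaches `N`. -/
theorem mem_range_of_mem_pow {A : Type u} [CommRing A] {V : Type u}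
    [CommRing V] [Algebra A V] {n : Ideal V}
    (hone : ∀ (i : ℕ) (x y : V), x ∈ n ^ i → y ∈ n ^ i → y ∉ n ^ (i + 1) →
      ∃ a : A, x - algebraMap A V a * y ∈ n ^ (i + 1))
    {N : ℕ} (hN : ∀ x ∈ n ^ N, x ∈ Set.range (algebraMap A V))
    {c : ℕ} (hc : ∀ i, c ≤ i → i ∈ valueSemigroup A n) :
    ∀ x ∈ n ^ c, x ∈ Set.range (algebraMap A V) := by
  suffices h : ∀ k i, c ≤ i → N ≤ i + k → ∀ x ∈ n ^ i, x ∈ Set.range (algebraMap A V) from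
    h N c le_rfl (by omega)
  intro k
  induction k with
  | zero => exact fun i _ hi x hx => hN x (Ideal.pow_le_pow_right (by omega) hx)
  | succ k ih =>
    intro i hci hi x hx
    obtain ⟨a, ha, ha'⟩ := mem_valueSemigroup_iff.1 (hc i hci)
    obtain ⟨b, hb⟩ := hone i x _ hx ha ha'
    obtain ⟨t, ht⟩ := ih (i + 1) (by omega) (by omega) _ hb
    exact ⟨t + b * a, by rw [map_add, ht, map_mul]; ring⟩

/-! ### From Gorenstein rings to injective dimension and back -/

section Gorenstein

open CategoryTheory

attribute [local instance] RingHomInvPair.of_ringEquiv in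
theorem hasInjectiveDimensionLE_self_of_ringEquiv {R S : Type u} [CommRing R] [CommRing S]
    (e : R ≃+* S) {d : ℕ} (h : HasInjectiveDimensionLE (ModuleCat.of S S) d) :
    HasInjectiveDimensionLE (ModuleCat.of R R) d := by
  let e' : R ≃ₛₗ[RingHomClass.toRingHom e] S :=
    { e.toAddEquiv with map_smul' := fun a b => map_mul e a b }
  exact (ModuleCat.hasInjectiveDimensionLE_iff_of_semiLinearEquiv e
    (M := ModuleCat.of R R) (N := ModuleCat.of S S) e' d).2 h

theorem IsGorensteinRing.exists_hasInjectiveDimensionLE {R : Type u} [CommRing R] [IsLocalRing R]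
    (h : IsGorensteinRing R) : ∃ d, HasInjectiveDimensionLE (ModuleCat.of R R) d := by
  obtain ⟨d, hd⟩ := h.2 (IsLocalRing.maximalIdeal R)
  have e : R ≃ₐ[R] Localization.AtPrime (IsLocalRing.maximalIdeal R) :=
    IsLocalization.atUnits R (IsLocalRing.maximalIdeal R).primeCompl
      (fun x hx => IsLocalRing.notMem_maximalIdeal.1 hx)
  exact ⟨d, hasInjectiveDimensionLE_self_of_ringEquiv e.toRingEquiv hd⟩

theorem IsGorensteinRing.of_injective {R : Type u} [CommRing R] [hR : IsNoetherianRing R]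
    (h : Module.Injective R R) : IsGorensteinRing R := by
  refine ⟨hR, fun p _ => ⟨0, ?_⟩⟩
  have : Module.Injective (Localization.AtPrime p) (Localization.AtPrime p) :=
    Module.injective_of_isLocalizedModule p.primeCompl
      (Algebra.linearMap R (Localization.AtPrime p))
  have : CategoryTheory.Injective
      (ModuleCat.of (Localization.AtPrime p) (Localization.AtPrime p)) :=
    Module.injective_object_of_injective_module _ _
  exact injective_iff_hasInjectiveDimensionLT_one.1 this

end Gorenstein

/-! ### Counting in a numerical semigroup -/

section NumericalSemigroup

variable {H : Set ℕ} {c : ℕ}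

/-- The elements of `H` which do not divide `s` in the additive monoid `H`. -/
def nonDivisors (H : Set ℕ) (s : ℕ) : Set ℕ :=
  {h | h ∈ H ∧ ¬ ∃ g ∈ H, h + g = s}

theorem exists_nonDivisors_eq_iff (h0 : 0 ∈ H) (hadd : ∀ i ∈ H, ∀ j ∈ H, i + j ∈ H)
    (hc : ∀ i, c ≤ i → i ∈ H) (hF : ∀ F, F + 1 = c → F ∉ H)
    (hsymm : ∀ i j, i + j + 1 = c → i ∉ H → j ∈ H) {s : ℕ} (hs : s ∈ H) :
    (∃ a ∈ H, nonDivisors H s = {h | ∃ b ∈ H, a + b = h}) ↔ ∃ a ∈ H, s + 1 = a + c := by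
  constructor
  · rintro ⟨a, ha, hE⟩
    refine ⟨a, ha, ?_⟩
    have hmem (h : ℕ) : (h ∈ H ∧ ¬ ∃ g ∈ H, h + g = s) ↔ ∃ b ∈ H, a + b = h :=
      Set.ext_iff.1 hE h
    have ha0 : a ≠ 0 := by
      rintro rfl
      exact ((hmem 0).2 ⟨0, h0, rfl⟩).2 ⟨s, hs, by simp⟩
    have hlt : s < a + c := by
      by_contra hle
      exact ((hmem s).2 ⟨s - a, hc _ (by omega), by omega⟩).2 ⟨0, h0, by simp⟩
    have hge : a + c ≤ s + 1 := by
      -- `a + c - 1` lies in `H` because `a ≥ 1`, but not in `a + H` because `c - 1` is a gap. So it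
      -- divides `s`, which bounds `s` from below.
      have h1 : a + c - 1 ∈ H := hc _ (by omega)
      have h2 : ¬ ∃ b ∈ H, a + b = a + c - 1 := by
        rintro ⟨b, hb, hab⟩
        exact hF b (by omega) hb
      have h3 : ∃ g ∈ H, a + c - 1 + g = s := by
        by_contra h3
        exact h2 ((hmem _).1 ⟨h1, h3⟩)
      obtain ⟨g, -, hg⟩ := h3
      omega
    omega
  · rintro ⟨a, ha, has⟩
    refine ⟨a, ha, Set.ext fun h => ⟨?_, ?_⟩⟩
    · rintro ⟨hh, hg⟩
      by_contra hab
      have hlt (h' : h < a) : False := hg ⟨s - h, hc _ (by omega), by omega⟩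
      have hah : a ≤ h := by
        by_contra hc'
        exact hlt (by omega)
      have hb : h - a ∉ H := fun hb => hab ⟨h - a, hb, by omega⟩
      have hbc : h - a < c := by
        by_contra hc'
        exact hb (hc _ (by omega))
      -- The only use of symmetry in this lemma: the reflection of the gap `h - a` is the cofactor
      -- `s - h`.
      exact hg ⟨c - 1 - (h - a), hsymm _ _ (by omega) hb, by omega⟩
    · rintro ⟨b, hb, rfl⟩
      refine ⟨hadd _ ha _ hb, ?_⟩
      rintro ⟨g, hg, hgs⟩
      exact hF (b + g) (by omega) (hadd _ hb _ hg)

theorem encard_setOf_not_exists_add_eq (hc : ∀ i, c ≤ i → i ∈ H) (hF : ∀ F, F + 1 = c → F ∉ H)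
    (h0 : 0 ∈ H) : {s | s ∈ H ∧ ¬ ∃ a ∈ H, s + 1 = a + c}.encard = c := by
  classical
  -- A gap `i` is positive, so its image `c + i - 1` is at least `c` and cannot meet the values
  -- below `c`, which are fixed.
  let φ : ℕ → ℕ := fun i => if i ∈ H then i else c + i - 1
  have hpos {i : ℕ} (hi : i ∉ H) : 0 < i := Nat.pos_of_ne_zero fun h => hi (h ▸ h0)
  have himage : {s | s ∈ H ∧ ¬ ∃ a ∈ H, s + 1 = a + c} = φ '' (Finset.range c : Set ℕ) := by
    ext s
    simp only [Set.mem_ofPred_eq, Set.mem_image, Finset.coe_range, Set.mem_Iio]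
    constructor
    · rintro ⟨hs, hsa⟩
      by_cases hsc : s < c
      · exact ⟨s, hsc, if_pos hs⟩
      · have hj : s - c + 1 ∉ H := fun hj => hsa ⟨_, hj, by omega⟩
        refine ⟨s - c + 1, ?_, ?_⟩
        · by_contra h
          exact hj (hc _ (by omega))
        · simp only [φ, if_neg hj]; omega
    · rintro ⟨i, hi, rfl⟩
      by_cases hiH : i ∈ H
      · simp only [φ, if_pos hiH]
        refine ⟨hiH, ?_⟩
        rintro ⟨a, -, ha⟩
        exact hF i (by omega) hiH
      · have := hpos hiH
        simp only [φ, if_neg hiH]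
        refine ⟨hc _ (by omega), ?_⟩
        rintro ⟨a, ha, hac⟩
        exact hiH (by convert ha using 1; omega)
  have hinj : Set.InjOn φ (Finset.range c : Set ℕ) := by
    intro i hi j hj hij
    simp only [Finset.coe_range, Set.mem_Iio] at hi hj
    simp only [φ] at hij
    split_ifs at hij with h1 h2 h2
    · exact hij
    · have := hpos h2; omega
    · have := hpos h1; omega
    · have := hpos h1; have := hpos h2; omega
  rw [himage, hinj.encard_image, Set.encard_coe_eq_coe_finsetCard, Finset.card_range]

end NumericalSemigroup

/-! ### Graded ideals of a monomial associated graded ring -/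

namespace IdealFiltration

variable {A : Type u} [CommRing A] (F : IdealFiltration A)

/-- The degrees in which the associated graded ring is nonzero. -/
def values : Set ℕ :=
  {i | ∃ x ∈ F.ideal i, x ∉ F.ideal (i + 1)}

/-- A filtration whose associated graded ring is like a numerical semigroup ring: products of
nonzero homogeneous elements are nonzero, and homogeneous elements of the same degree are
proportional. -/
structure IsMonomial : Prop where
  one_notMem : (1 : A) ∉ F.ideal 1
  mul_notMem : ∀ i j x y, x ∈ F.ideal i → x ∉ F.ideal (i + 1) → y ∈ F.ideal j →
    y ∉ F.ideal (j + 1) → x * y ∉ F.ideal (i + j + 1)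
  exists_sub_mem : ∀ i x y, x ∈ F.ideal i → y ∈ F.ideal i → y ∉ F.ideal (i + 1) →
    ∃ a : A, x - a * y ∈ F.ideal (i + 1)

variable {F}

theorem cls_eq_zero_iff {i : ℕ} {x : F.ideal i} : F.cls i x = 0 ↔ (x : A) ∈ F.ideal (i + 1) := by
  rw [← F.cls_zero, F.cls_eq_iff]
  simp

theorem mem_values_iff {i : ℕ} : i ∈ F.values ↔ ∃ x : F.GrPiece i, x ≠ 0 := by
  constructor
  · rintro ⟨x, hx, hx'⟩
    exact ⟨F.cls i ⟨x, hx⟩, fun h => hx' (cls_eq_zero_iff.1 h)⟩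
  · rintro ⟨x, hx⟩
    obtain ⟨x, rfl⟩ := F.cls_surjective i x
    exact ⟨x, x.2, fun h => hx (cls_eq_zero_iff.2 h)⟩

theorem mem_values_of_ne_zero {i : ℕ} {x : F.GrPiece i} (hx : x ≠ 0) : i ∈ F.values :=
  mem_values_iff.2 ⟨x, hx⟩

/-- The homogeneous element of degree `i` defined by a class in `F i / F (i + 1)`. -/
noncomputable abbrev hom (F : IdealFiltration A) (i : ℕ) (x : F.GrPiece i) : F.AssociatedGraded :=
  DirectSum.of F.GrPiece i x

theorem hom_mul_hom {i j : ℕ} (x : F.GrPiece i) (y : F.GrPiece j) :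
    F.hom i x * F.hom j y = F.hom (i + j) (F.grMul x y) :=
  DirectSum.of_mul_of x y

theorem hom_zero_mul_hom (a : A) {i : ℕ} (x : F.ideal i) :
    F.hom 0 (F.cls 0 (F.ofRing a)) * F.hom i (F.cls i x) = F.hom i (F.cls i (a • x)) := by
  rw [hom_mul_hom, grMul_cls]
  exact DirectSum.of_eq_of_gradedMonoid_eq (F.mk_cls_eq (zero_add i) _ _ rfl)

theorem hom_pow (i : ℕ) (x : F.GrPiece i) (k : ℕ) : ∃ z, F.hom i x ^ k = F.hom (k * i) z := by
  induction k with
  | zero =>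
    rw [Nat.zero_mul]
    exact ⟨F.cls 0 (F.ofRing 1), pow_zero _⟩
  | succ k ih =>
    obtain ⟨z, hz⟩ := ih
    rw [pow_succ, hz, hom_mul_hom, Nat.succ_mul]
    exact ⟨_, rfl⟩

/-- The elements of the associated graded ring supported in a set of degrees. -/
def supported (F : IdealFiltration A) (E : Set ℕ) : AddSubgroup F.AssociatedGraded where
  carrier := {f | ∀ i, f i ≠ 0 → i ∈ E}
  zero_mem' := fun i hi => absurd rfl hi
  add_mem' := by
    intro a b ha hb i hi
    by_contra hE
    refine hi ?_
    rw [DirectSum.add_apply, not_not.1 (mt (ha i) hE), not_not.1 (mt (hb i) hE), add_zero]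
  neg_mem' := by
    intro a ha i hi
    refine ha i fun h => hi ?_
    change - (a i) = 0
    rw [h, neg_zero]

theorem mem_supported {E : Set ℕ} {f : F.AssociatedGraded} :
    f ∈ F.supported E ↔ ∀ i, f i ≠ 0 → i ∈ E := Iff.rfl

theorem supported_mono {E E' : Set ℕ} (h : ∀ i ∈ F.values, i ∈ E → i ∈ E') :
    F.supported E ≤ F.supported E' :=
  fun _ hf i hi => h i (mem_values_of_ne_zero hi) (hf i hi)

theorem hom_mem_supported {E : Set ℕ} {i : ℕ} {x : F.GrPiece i} (h : x ≠ 0 → i ∈ E) :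
    F.hom i x ∈ F.supported E := by
  intro j hj
  by_cases hij : i = j
  · subst hij
    rw [DirectSum.of_eq_same] at hj
    exact h hj
  · exact absurd (DirectSum.of_eq_of_ne _ _ _ (Ne.symm hij)) hj

theorem mem_of_hom_mem_supported {E : Set ℕ} {i : ℕ} {x : F.GrPiece i}
    (h : F.hom i x ∈ F.supported E) (hx : x ≠ 0) : i ∈ E :=
  h i (by rwa [DirectSum.of_eq_same])

/-- To prove that an element lies in an additive subgroup, it suffices to treat its homogeneous
components. -/
theorem mem_of_forall_hom_mem {f : F.AssociatedGraded} {S : AddSubgroup F.AssociatedGraded}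
    (h : ∀ i, f i ≠ 0 → F.hom i (f i) ∈ S) : f ∈ S := by
  classical
  rw [← DirectSum.sum_support_of f]
  exact sum_mem fun i hi => h i (by simpa using hi)

theorem mul_mem_supported {E₁ E₂ E₃ : Set ℕ}
    (h : ∀ i ∈ E₁, ∀ j ∈ E₂, i ∈ F.values → j ∈ F.values → i + j ∈ F.values → i + j ∈ E₃)
    {f g : F.AssociatedGraded} (hf : f ∈ F.supported E₁) (hg : g ∈ F.supported E₂) :
    f * g ∈ F.supported E₃ := by
  have key : f ∈ (F.supported E₃).comap (AddMonoidHom.mulRight g) := by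
    refine mem_of_forall_hom_mem fun i hi => ?_
    change F.hom i (f i) * g ∈ F.supported E₃
    have : g ∈ (F.supported E₃).comap
        (AddMonoidHom.mulLeft (F.hom i (f i)) : F.AssociatedGraded →+ F.AssociatedGraded) := by
      refine mem_of_forall_hom_mem fun j hj => ?_
      change F.hom i (f i) * F.hom j (g j) ∈ F.supported E₃
      rw [hom_mul_hom]
      exact hom_mem_supported fun hne => h i (hf i hi) j (hg j hj) (mem_values_of_ne_zero hi)
        (mem_values_of_ne_zero hj) (mem_values_of_ne_zero hne)
    exact this
  exact key

theorem mem_supported_univ (f : F.AssociatedGraded) : f ∈ F.supported Set.univ :=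
  fun _ _ => trivial

theorem sub_hom_mem_supported {E : Set ℕ} {f : F.AssociatedGraded} {i : ℕ}
    (h : ∀ j, j ≠ i → f j ≠ 0 → j ∈ E) : f - F.hom i (f i) ∈ F.supported E := by
  intro j hj
  rw [DirectSum.sub_apply] at hj
  by_cases hij : i = j
  · subst hij
    rw [DirectSum.of_eq_same, sub_self] at hj
    exact absurd rfl hj
  · rw [DirectSum.of_eq_of_ne _ _ _ (Ne.symm hij), sub_zero] at hj
    exact h j (Ne.symm hij) hj

/-- The graded ideal of elements supported in an ideal `E` of the semigroup of values. -/
def supportedIdeal (E : Set ℕ) (hE : ∀ i ∈ E, ∀ j ∈ F.values, i + j ∈ E) :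
    Ideal F.AssociatedGraded where
  __ := F.supported E
  smul_mem' := by
    intro g f hf
    have hf' : f ∈ F.supported E := hf
    rw [smul_eq_mul]
    exact mul_mem_supported (E₁ := Set.univ)
      (fun i _ j hj hi _ _ => add_comm j i ▸ hE j hj i hi) (mem_supported_univ g) hf'

theorem mem_supportedIdeal {E : Set ℕ} {hE : ∀ i ∈ E, ∀ j ∈ F.values, i + j ∈ E}
    {f : F.AssociatedGraded} : f ∈ supportedIdeal E hE ↔ f ∈ F.supported E := Iff.rfl

theorem isGradedIdeal_supportedIdeal (E : Set ℕ) (hE : ∀ i ∈ E, ∀ j ∈ F.values, i + j ∈ E) :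
    F.IsGradedIdeal (supportedIdeal E hE) :=
  fun _ hf i => mem_supportedIdeal.2 (hom_mem_supported (hf i))

/-- The degrees of the nonzero homogeneous elements of an ideal. -/
def degrees (I : Ideal F.AssociatedGraded) : Set ℕ :=
  {i | ∃ x : F.GrPiece i, x ≠ 0 ∧ F.hom i x ∈ I}

theorem degrees_subset_values (I : Ideal F.AssociatedGraded) : degrees I ⊆ F.values :=
  fun _ ⟨_, hx, _⟩ => mem_values_of_ne_zero hx

theorem degrees_supportedIdeal {E : Set ℕ} (hE : ∀ i ∈ E, ∀ j ∈ F.values, i + j ∈ E)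
    (hEv : E ⊆ F.values) : degrees (supportedIdeal E hE) = E := by
  ext i
  constructor
  · rintro ⟨x, hx, hxI⟩
    exact mem_of_hom_mem_supported hxI hx
  · intro hi
    obtain ⟨x, hx⟩ := mem_values_iff.1 (hEv hi)
    exact ⟨x, hx, mem_supportedIdeal.2 (hom_mem_supported fun _ => hi)⟩

/-- The irrelevant ideal, of elements of positive degree. -/
def irrelevant (F : IdealFiltration A) : Ideal F.AssociatedGraded :=
  supportedIdeal (Set.Ioi 0) fun _ hi j _ => Nat.add_pos_left hi j

theorem one_eq_hom : (1 : F.AssociatedGraded) = F.hom 0 (F.cls 0 (F.ofRing 1)) := rfl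

namespace IsMonomial

variable (hF : F.IsMonomial)
include hF

theorem zero_mem_values : 0 ∈ F.values :=
  ⟨1, by rw [F.ideal_zero]; trivial, hF.one_notMem⟩

theorem grMul_ne_zero {i j : ℕ} {x : F.GrPiece i} {y : F.GrPiece j} (hx : x ≠ 0) (hy : y ≠ 0) :
    F.grMul x y ≠ 0 := by
  obtain ⟨x, rfl⟩ := F.cls_surjective i x
  obtain ⟨y, rfl⟩ := F.cls_surjective j y
  rw [grMul_cls, Ne, cls_eq_zero_iff]
  exact hF.mul_notMem i j x y x.2 (mt cls_eq_zero_iff.2 hx) y.2 (mt cls_eq_zero_iff.2 hy)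

theorem add_mem_values {i j : ℕ} (hi : i ∈ F.values) (hj : j ∈ F.values) : i + j ∈ F.values := by
  obtain ⟨x, hx⟩ := mem_values_iff.1 hi
  obtain ⟨y, hy⟩ := mem_values_iff.1 hj
  exact mem_values_of_ne_zero (hF.grMul_ne_zero hx hy)

theorem exists_hom_eq_mul {i : ℕ} (x : F.GrPiece i) {y : F.GrPiece i} (hy : y ≠ 0) :
    ∃ r, F.hom i x = r * F.hom i y := by
  obtain ⟨x, rfl⟩ := F.cls_surjective i x
  obtain ⟨y, rfl⟩ := F.cls_surjective i y
  obtain ⟨a, ha⟩ := hF.exists_sub_mem i x y x.2 y.2 (mt cls_eq_zero_iff.2 hy)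
  refine ⟨F.hom 0 (F.cls 0 (F.ofRing a)), ?_⟩
  rw [hom_zero_mul_hom]
  congr 1
  exact F.cls_eq_iff.2 ha

theorem exists_hom_add_eq_mul {i j k : ℕ} (hk : i + j = k) (z : F.GrPiece k) {x : F.GrPiece i}
    {y : F.GrPiece j} (hx : x ≠ 0) (hy : y ≠ 0) :
    ∃ r, F.hom k z = r * (F.hom i x * F.hom j y) := by
  subst hk
  rw [hom_mul_hom]
  exact hF.exists_hom_eq_mul z (hF.grMul_ne_zero hx hy)

theorem hom_mem_of_mem_degrees {I : Ideal F.AssociatedGraded} {i : ℕ} (hi : i ∈ degrees I)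
    (x : F.GrPiece i) : F.hom i x ∈ I := by
  obtain ⟨y, hy, hyI⟩ := hi
  obtain ⟨r, hr⟩ := hF.exists_hom_eq_mul x hy
  rw [hr]
  exact I.mul_mem_left _ hyI

theorem add_mem_degrees {I : Ideal F.AssociatedGraded} {i j : ℕ} (hi : i ∈ degrees I)
    (hj : j ∈ F.values) : i + j ∈ degrees I := by
  obtain ⟨x, hx, hxI⟩ := hi
  obtain ⟨y, hy⟩ := mem_values_iff.1 hj
  exact ⟨_, hF.grMul_ne_zero hx hy, by rw [← hom_mul_hom]; exact I.mul_mem_right _ hxI⟩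

theorem eq_supportedIdeal_degrees {I : Ideal F.AssociatedGraded} (hI : F.IsGradedIdeal I) :
    I = supportedIdeal (degrees I) (fun _ hi _ hj => hF.add_mem_degrees hi hj) := by
  ext f
  rw [mem_supportedIdeal]
  constructor
  · exact fun hf i hi => ⟨f i, hi, hI f hf i⟩
  · exact fun hf => mem_of_forall_hom_mem (S := I.toAddSubgroup)
      fun i hi => hF.hom_mem_of_mem_degrees (hf i hi) _

theorem mem_iff_supported_degrees {I : Ideal F.AssociatedGraded} (hI : F.IsGradedIdeal I)
    {f : F.AssociatedGraded} : f ∈ I ↔ f ∈ F.supported (degrees I) := by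
  conv_lhs => rw [hF.eq_supportedIdeal_degrees hI]
  exact mem_supportedIdeal

theorem isMaximal_irrelevant : F.irrelevant.IsMaximal := by
  have h1 : F.cls 0 (F.ofRing 1) ≠ 0 := mt cls_eq_zero_iff.1 hF.one_notMem
  rw [Ideal.isMaximal_iff]
  refine ⟨fun h => ?_, fun J f hJ hf hfJ => ?_⟩
  · rw [one_eq_hom] at h
    exact lt_irrefl 0 (mem_of_hom_mem_supported h h1)
  · have hf0 : f 0 ≠ 0 := by
      intro h0
      refine hf (mem_supportedIdeal.2 fun i hi => Nat.pos_of_ne_zero ?_)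
      rintro rfl
      exact hi h0
    have h2 : f - F.hom 0 (f 0) ∈ J := hJ (mem_supportedIdeal.2
      (sub_hom_mem_supported fun j hj _ => Nat.pos_of_ne_zero hj))
    have h3 : F.hom 0 (f 0) ∈ J := by
      have := J.sub_mem hfJ h2
      rwa [sub_sub_cancel] at this
    obtain ⟨r, hr⟩ := hF.exists_hom_eq_mul (F.cls 0 (F.ofRing 1)) hf0
    rw [one_eq_hom, hr]
    exact J.mul_mem_left _ h3

/-- The `N`-th power of a homogeneous element of positive degree has degree at least `N`, so it lies
in `I`. -/
theorem eq_irrelevant_of_isPrime {I P : Ideal F.AssociatedGraded} (hP : P.IsPrime) (hIP : I ≤ P)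
    {N : ℕ} (hN : ∀ i, N ≤ i → ∀ x, F.hom i x ∈ I) : P = F.irrelevant := by
  refine (hF.isMaximal_irrelevant.eq_of_le hP.ne_top fun f hf => ?_).symm
  refine mem_of_forall_hom_mem (S := P.toAddSubgroup) fun i hi => ?_
  have hi0 : 0 < i := hf i hi
  obtain ⟨z, hz⟩ := hom_pow i (f i) N
  refine hP.mem_of_pow_mem N (hIP ?_)
  rw [hz]
  exact hN _ (Nat.le_mul_of_pos_right N hi0) z

end IsMonomial

end IdealFiltration

theorem Set.exists_mem_forall_le_of_forall_lt {D : Set ℕ} (hD : D.Nonempty) {N : ℕ}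
    (hN : ∀ t ∈ D, t < N) : ∃ s ∈ D, ∀ t ∈ D, t ≤ s := by
  have hb : BddAbove D := ⟨N, fun t ht => (hN t ht).le⟩
  exact ⟨sSup D, Nat.sSup_mem hD hb, fun t ht => le_csSup hb ht⟩

namespace IdealFiltration.IsMonomial

variable {A : Type u} [CommRing A] {F : IdealFiltration A} (hF : F.IsMonomial)
include hF

/-! ### Gorenstein quotients in terms of degrees -/

section Quotient

variable {I : Ideal F.AssociatedGraded} {N : ℕ} (hN : ∀ i, N ≤ i → ∀ x, F.hom i x ∈ I)
include hN

theorem eq_map_irrelevant_of_isPrime {J : Ideal (F.AssociatedGraded ⧸ I)} (hJ : J.IsPrime) :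
    J = F.irrelevant.map (Ideal.Quotient.mk I) := by
  have hsurj : Function.Surjective (Ideal.Quotient.mk I) := Ideal.Quotient.mk_surjective
  rw [← hF.eq_irrelevant_of_isPrime (hJ.comap (Ideal.Quotient.mk I)) (fun f hf => by
    rw [Ideal.mem_comap, Ideal.Quotient.eq_zero_iff_mem.2 hf]; exact J.zero_mem) hN]
  exact (Ideal.map_comap_of_surjective _ hsurj J).symm

theorem fg_map_irrelevant : (F.irrelevant.map (Ideal.Quotient.mk I)).FG := by
  classical
  have hτ (i : ℕ) : ∃ τ : F.GrPiece i, i ∈ F.values → τ ≠ 0 := by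
    by_cases hi : i ∈ F.values
    · obtain ⟨x, hx⟩ := mem_values_iff.1 hi
      exact ⟨x, fun _ => hx⟩
    · exact ⟨0, fun h => absurd h hi⟩
  choose τ hτ using hτ
  let T : Finset F.AssociatedGraded := (Finset.Ioo 0 N).image fun i => F.hom i (τ i)
  have hT : F.irrelevant ≤ I ⊔ Ideal.span (T : Set F.AssociatedGraded) := by
    intro f hf
    refine mem_of_forall_hom_mem
      (S := (I ⊔ Ideal.span (T : Set F.AssociatedGraded)).toAddSubgroup) fun i hi => ?_
    change F.hom i (f i) ∈ I ⊔ Ideal.span (T : Set F.AssociatedGraded)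
    have hi0 : 0 < i := hf i hi
    by_cases hiN : N ≤ i
    · exact Ideal.mem_sup_left (hN i hiN _)
    · obtain ⟨r, hr⟩ := hF.exists_hom_eq_mul (f i) (hτ i (mem_values_of_ne_zero hi))
      rw [hr]
      refine Ideal.mem_sup_right (Ideal.mul_mem_left _ _ (Ideal.subset_span ?_))
      simp only [T, Finset.coe_image]
      exact ⟨i, by simp; omega, rfl⟩
  have hT' : Ideal.span (T : Set F.AssociatedGraded) ≤ F.irrelevant := by
    rw [Ideal.span_le]
    intro f hf
    simp only [T, Finset.coe_image] at hf
    obtain ⟨i, hi, rfl⟩ := hf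
    simp only [Finset.coe_Ioo, Set.mem_Ioo] at hi
    exact mem_supportedIdeal.2 (hom_mem_supported fun _ => hi.1)
  have : F.irrelevant.map (Ideal.Quotient.mk I) =
      (Ideal.span (T : Set F.AssociatedGraded)).map (Ideal.Quotient.mk I) := by
    refine le_antisymm ((Ideal.map_mono hT).trans ?_) (Ideal.map_mono hT')
    rw [Ideal.map_sup, Ideal.map_quotient_self, bot_sup_eq]
  rw [this]
  exact Ideal.FG.map ⟨T, rfl⟩ _

/-- The only possible prime is the image of the irrelevant ideal, which is finitely generated;
Cohen's theorem gives the Noetherian property, and the dimension is zero. -/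
theorem isArtinianRing_quotient : IsArtinianRing (F.AssociatedGraded ⧸ I) := by
  rw [isArtinianRing_iff_isNoetherianRing_krullDimLE_zero]
  refine ⟨IsNoetherianRing.of_prime fun J hJ => ?_, Ring.krullDimLE_zero_iff.2 fun J hJ => ?_⟩
  · rw [hF.eq_map_irrelevant_of_isPrime hN hJ]
    exact hF.fg_map_irrelevant hN
  · obtain ⟨M, hM, -⟩ := Ideal.exists_le_maximal J hJ.ne_top
    rw [hF.eq_map_irrelevant_of_isPrime hN hJ, ← hF.eq_map_irrelevant_of_isPrime hN hM.isPrime]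
    exact hM

theorem isLocalRing_quotient (hI : I ≠ ⊤) : IsLocalRing (F.AssociatedGraded ⧸ I) := by
  have : Nontrivial (F.AssociatedGraded ⧸ I) := Ideal.Quotient.nontrivial_iff.2 hI
  obtain ⟨M, hM⟩ := Ideal.exists_maximal (F.AssociatedGraded ⧸ I)
  refine IsLocalRing.of_unique_max_ideal ⟨M, hM, fun J hJ => ?_⟩
  have hJ' : J.IsMaximal := hJ
  rw [hF.eq_map_irrelevant_of_isPrime hN hJ'.isPrime,
    hF.eq_map_irrelevant_of_isPrime hN hM.isPrime]

/-- The homogeneous elements of `G ⧸ I` whose degree cannot be raised lie in the socle. -/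
theorem mul_mk_hom_eq_zero [IsLocalRing (F.AssociatedGraded ⧸ I)] (hI : F.IsGradedIdeal I) {t : ℕ}
    (x : F.GrPiece t) (ht : ∀ g ∈ F.values, 0 < g → t + g ∈ degrees I)
    (r : F.AssociatedGraded ⧸ I) (hr : r ∈ IsLocalRing.maximalIdeal (F.AssociatedGraded ⧸ I)) :
    r * Ideal.Quotient.mk I (F.hom t x) = 0 := by
  rw [hF.eq_map_irrelevant_of_isPrime hN
    (IsLocalRing.maximalIdeal.isMaximal (F.AssociatedGraded ⧸ I)).isPrime] at hr
  obtain ⟨q, hq, rfl⟩ := (Ideal.mem_map_iff_of_surjective _ Ideal.Quotient.mk_surjective).1 hr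
  rw [← map_mul, Ideal.Quotient.eq_zero_iff_mem, hF.mem_iff_supported_degrees hI]
  refine mul_mem_supported (E₁ := Set.Ioi 0) (E₂ := {t}) ?_ hq
    (hom_mem_supported fun _ => rfl)
  rintro i hi j rfl hiv - -
  rw [add_comm]
  exact ht i hiv hi

/-- The top degree `s` outside `degrees I` carries a socle element. For any other `h` outside, the
largest element `t` of `h + H` outside `degrees I` carries one too. Simplicity of the socle makes
the second a multiple of the first, so `t = s` and `h` divides `s`. -/
theorem exists_degrees_eq_nonDivisors (hI : F.IsGradedIdeal I) (hI1 : I ≠ ⊤)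
    (hG : IsGorensteinRing (F.AssociatedGraded ⧸ I)) :
    ∃ s ∈ F.values, degrees I = nonDivisors F.values s := by
  have := hF.isArtinianRing_quotient hN
  have := hF.isLocalRing_quotient hN hI1
  obtain ⟨d, hd⟩ := hG.exists_hasInjectiveDimensionLE
  let D : Set ℕ := F.values \ degrees I
  have hDN (t : ℕ) (ht : t ∈ D) : t < N := by
    by_contra hc
    obtain ⟨x, hx⟩ := mem_values_iff.1 ht.1
    exact ht.2 ⟨x, hx, hN t (by omega) x⟩
  have h0D : 0 ∈ D := by
    refine ⟨hF.zero_mem_values, fun h => hI1 ?_⟩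
    rw [Ideal.eq_top_iff_one, one_eq_hom]
    exact hF.hom_mem_of_mem_degrees h _
  obtain ⟨s, hsD, hs⟩ := Set.exists_mem_forall_le_of_forall_lt ⟨0, h0D⟩ hDN
  refine ⟨s, hsD.1, Set.ext fun h => ⟨fun hh => ⟨degrees_subset_values I hh, ?_⟩, ?_⟩⟩
  · rintro ⟨g, hg, rfl⟩
    exact hsD.2 (hF.add_mem_degrees hh hg)
  rintro ⟨hh, hnd⟩
  by_contra hhE
  obtain ⟨t, ⟨htD, g, hg, hgt⟩, ht⟩ := Set.exists_mem_forall_le_of_forall_lt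
    (D := {t | t ∈ D ∧ ∃ g ∈ F.values, h + g = t}) (N := N)
    ⟨h, ⟨hh, hhE⟩, 0, hF.zero_mem_values, rfl⟩ (fun t ht => hDN t ht.1)
  obtain ⟨x, hx⟩ := mem_values_iff.1 hsD.1
  obtain ⟨z, hz⟩ := mem_values_iff.1 htD.1
  have hx0 : Ideal.Quotient.mk I (F.hom s x) ≠ 0 := by
    rw [Ne, Ideal.Quotient.eq_zero_iff_mem]
    exact fun hxI => hsD.2 ⟨x, hx, hxI⟩
  obtain ⟨r, hr⟩ := IsArtinianRing.exists_eq_mul_of_hasInjectiveDimensionLE hd hx0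
    (hF.mul_mk_hom_eq_zero hN hI x fun g hg hg0 => by
      by_contra hc
      have := hs (s + g) ⟨hF.add_mem_values hsD.1 hg, hc⟩
      omega)
    (hF.mul_mk_hom_eq_zero hN hI z fun g' hg' hg0 => by
      by_contra hc
      have := ht (t + g') ⟨⟨hF.add_mem_values htD.1 hg', hc⟩, g + g',
        hF.add_mem_values hg hg', by omega⟩
      omega)
  obtain ⟨r, rfl⟩ := Ideal.Quotient.mk_surjective r
  rw [← map_mul, Ideal.Quotient.eq, hF.mem_iff_supported_degrees hI] at hr
  have h1 : r * F.hom s x ∈ F.supported (Set.Ici s) := by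
    refine mul_mem_supported (E₁ := Set.univ) (E₂ := {s}) ?_ (mem_supported_univ r)
      (hom_mem_supported fun _ => rfl)
    rintro i - j rfl - - -
    exact Nat.le_add_left _ _
  have h2 : F.hom t z ∈ F.supported (degrees I ∪ Set.Ici s) := by
    rw [← sub_add_cancel (F.hom t z) (r * F.hom s x)]
    exact add_mem (supported_mono (fun _ _ => Or.inl) hr) (supported_mono (fun _ _ => Or.inr) h1)
  rcases mem_of_hom_mem_supported h2 hz with h3 | h3
  · exact htD.2 h3
  · have hts : t = s := le_antisymm (hs t htD) h3
    exact hnd ⟨g, hg, hgt.trans hts⟩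

/-- The degree `s` part generates the socle. If `h` is the lowest degree outside `degrees I` in
which `f` is nonzero, then `h + g = s` for some value `g`. Multiplying by an element of degree `g`
leaves only the component of degree `s`: higher terms land beyond `s`, and lower ones already lie in
`I`. -/
theorem isGorensteinRing_quotient (hI : F.IsGradedIdeal I) {s : ℕ} (hs : s ∈ F.values)
    (hE : degrees I = nonDivisors F.values s) : IsGorensteinRing (F.AssociatedGraded ⧸ I) := by
  have hsE : s ∉ degrees I := by
    rw [hE]
    exact fun h => h.2 ⟨0, hF.zero_mem_values, rfl⟩
  obtain ⟨x, hx⟩ := mem_values_iff.1 hs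
  have hxI : F.hom s x ∉ I := fun h => hsE ⟨x, hx, h⟩
  have hI1 : I ≠ ⊤ := fun h => hxI (h ▸ trivial)
  have := hF.isArtinianRing_quotient hN
  have := hF.isLocalRing_quotient hN hI1
  refine IsGorensteinRing.of_injective (IsArtinianRing.injective_self_of_socle
    (s := Ideal.Quotient.mk I (F.hom s x)) (mt Ideal.Quotient.eq_zero_iff_mem.1 hxI) ?_)
  intro f hf
  obtain ⟨f, rfl⟩ := Ideal.Quotient.mk_surjective f
  rw [Ne, Ideal.Quotient.eq_zero_iff_mem, hF.mem_iff_supported_degrees hI, mem_supported] at hf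
  push Not at hf
  classical
  obtain ⟨hfh, hhE⟩ := Nat.find_spec hf
  set h := Nat.find hf with hh
  have hmin {j : ℕ} (hj : j < h) (hfj : f j ≠ 0) : j ∈ degrees I := by
    by_contra hc
    exact Nat.find_min hf hj ⟨hfj, hc⟩
  have hhv : h ∈ F.values := mem_values_of_ne_zero hfh
  obtain ⟨g, hg, hgs⟩ : ∃ g ∈ F.values, h + g = s := by
    by_contra hc
    exact hhE (hE ▸ ⟨hhv, hc⟩)
  obtain ⟨y, hy⟩ := mem_values_iff.1 hg
  have h1 : F.hom g y * (f - F.hom h (f h)) ∈ I := by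
    rw [hF.mem_iff_supported_degrees hI]
    refine mul_mem_supported (E₁ := {g}) (E₂ := degrees I ∪ Set.Ioi h) ?_
      (hom_mem_supported fun _ => rfl) (sub_hom_mem_supported fun j hj hfj => ?_)
    · rintro i rfl j (hj | hj) hi hjv hij
      · rw [add_comm]
        exact hF.add_mem_degrees hj hi
      · have hj' : h < j := hj
        rw [hE]
        exact ⟨hij, fun ⟨k, _, hk⟩ => by omega⟩
    · rcases lt_or_gt_of_ne hj with hlt | hgt
      · exact Or.inl (hmin hlt hfj)
      · exact Or.inr hgt
  obtain ⟨r, hr⟩ := hF.exists_hom_add_eq_mul ((add_comm g h).trans hgs) x hy hfh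
  refine ⟨Ideal.Quotient.mk I (r * F.hom g y), ?_⟩
  rw [← map_mul, Ideal.Quotient.eq, hr]
  convert I.mul_mem_left r h1 using 1
  ring

end Quotient

/-- A nonzero graded ideal is principal exactly if its degrees form a principal ideal of the
semigroup of values. -/
theorem exists_eq_span_singleton_iff {I : Ideal F.AssociatedGraded} (hI : F.IsGradedIdeal I)
    (hI0 : I ≠ ⊥) : (∃ f, I = Ideal.span {f}) ↔
      ∃ a ∈ F.values, degrees I = {h | ∃ b ∈ F.values, a + b = h} := by
  classical
  constructor
  · rintro ⟨f, rfl⟩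
    -- The generator need not be homogeneous, so lowest components are compared: those of `g` and
    -- `f` have nonzero product, which must be the lowest component of the homogeneous element `g *
    -- f`.
    have hlow (g : F.AssociatedGraded) (hg : g ≠ 0) :
        ∃ a, g a ≠ 0 ∧ g - F.hom a (g a) ∈ F.supported (Set.Ioi a) := by
      have hex : ∃ a, g a ≠ 0 := by
        by_contra! hc
        exact hg (DFinsupp.ext hc)
      refine ⟨Nat.find hex, Nat.find_spec hex, sub_hom_mem_supported fun j hj hgj => ?_⟩
      exact lt_of_le_of_ne (Nat.find_min' hex hgj) (Ne.symm hj)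
    have hf0 : f ≠ 0 := by
      rintro rfl
      exact hI0 (by simp)
    obtain ⟨a, ha, hfa⟩ := hlow f hf0
    have hav := mem_values_of_ne_zero ha
    refine ⟨a, hav, Set.ext fun h => ⟨?_, ?_⟩⟩
    · rintro ⟨z, hz, hzI⟩
      obtain ⟨g, hg⟩ := Ideal.mem_span_singleton'.1 hzI
      have hg0 : g ≠ 0 := by
        rintro rfl
        rw [zero_mul] at hg
        exact hz (DirectSum.of_injective h (hg.symm.trans (map_zero _).symm))
      obtain ⟨b, hb, hgb⟩ := hlow g hg0
      refine ⟨b, mem_values_of_ne_zero hb, ?_⟩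
      have hfIci : f ∈ F.supported (Set.Ici a) := by
        rw [← sub_add_cancel f (F.hom a (f a))]
        exact add_mem (supported_mono (fun i _ (hi : a < i) => hi.le) hfa)
          (hom_mem_supported fun _ => le_refl a)
      have h1 : (g - F.hom b (g b)) * f ∈ F.supported (Set.Ioi (a + b)) :=
        mul_mem_supported (fun i (hi : b < i) j (hj : a ≤ j) _ _ _ =>
          show a + b < i + j by omega) hgb hfIci
      have h2 : F.hom b (g b) * (f - F.hom a (f a)) ∈ F.supported (Set.Ioi (a + b)) :=
        mul_mem_supported (E₁ := {b}) (fun i (hi : i = b) j (hj : a < j) _ _ _ =>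
          show a + b < i + j by omega) (hom_mem_supported fun _ => rfl) hfa
      have h3 : F.hom b (g b) * F.hom a (f a) - F.hom h z ∈ F.supported (Set.Ioi (a + b)) := by
        have := neg_mem (add_mem h1 h2)
        rw [← hg]
        convert this using 1
        ring
      have hne := hF.grMul_ne_zero hb ha
      by_contra hab
      rw [hom_mul_hom] at h3
      have := h3 (b + a) (by
        rw [DirectSum.sub_apply, DirectSum.of_eq_same,
          DirectSum.of_eq_of_ne _ _ _ (by omega), sub_zero]
        exact hne)
      have : a + b < b + a := this
      omega
    · rintro ⟨b, hb, rfl⟩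
      refine hF.add_mem_degrees ⟨f a, ha, ?_⟩ hb
      exact hI f (Ideal.mem_span_singleton_self f) a
  · rintro ⟨a, ha, hE⟩
    have haE : a ∈ degrees I := hE ▸ ⟨0, hF.zero_mem_values, rfl⟩
    obtain ⟨x, hx, hxI⟩ := haE
    refine ⟨F.hom a x, le_antisymm ?_ ((Ideal.span_singleton_le_iff_mem _).2 hxI)⟩
    intro f hf
    refine mem_of_forall_hom_mem (S := (Ideal.span {F.hom a x}).toAddSubgroup) fun i hi => ?_
    have hiE : i ∈ degrees I := (hF.mem_iff_supported_degrees hI).1 hf i hi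
    rw [hE] at hiE
    obtain ⟨b, hb, hab⟩ := hiE
    obtain ⟨y, hy⟩ := mem_values_iff.1 hb
    obtain ⟨r, hr⟩ := hF.exists_hom_add_eq_mul hab (f i) hx hy
    change F.hom i (f i) ∈ Ideal.span {F.hom a x}
    rw [hr]
    exact Ideal.mul_mem_left _ _ (Ideal.mul_mem_right _ _ (Ideal.mem_span_singleton_self _))

end IdealFiltration.IsMonomial

/-! ### The count of Gorenstein graded ideals -/

theorem Submodule.two_le_spanRank_iff {R M : Type*} [CommRing R] [AddCommGroup M] [Module R M]
    {I : Submodule R M} : 2 ≤ I.spanRank ↔ ¬ ∃ f, I = Submodule.span R {f} := by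
  rw [← not_lt, not_iff_not]
  constructor
  · intro h
    obtain ⟨s, hs, rfl⟩ := I.exists_span_set_card_eq_spanRank
    rw [← hs] at h
    have h1 : s.Subsingleton := by
      intro x hx y hy
      by_contra hxy
      exact not_le.2 h (Cardinal.two_le_iff.2 ⟨⟨x, hx⟩, ⟨y, hy⟩, fun e => hxy (congrArg Subtype.val e)⟩)
    rcases h1.eq_empty_or_singleton with rfl | ⟨f, rfl⟩
    · exact ⟨0, by simp⟩
    · exact ⟨f, rfl⟩
  · rintro ⟨f, rfl⟩
    refine (Submodule.spanRank_span_le_card _).trans_lt ?_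
    rw [Cardinal.mk_singleton]
    exact Cardinal.one_lt_two

theorem injOn_nonDivisors {H : Set ℕ} (h0 : 0 ∈ H) : Set.InjOn (nonDivisors H) H := by
  have key {s s' : ℕ} (hs : s ∈ H) (h : nonDivisors H s = nonDivisors H s') : s ≤ s' := by
    have h1 : s ∉ nonDivisors H s' := h ▸ fun h => h.2 ⟨0, h0, rfl⟩
    have h2 : ∃ g ∈ H, s + g = s' := by
      by_contra hc
      exact h1 ⟨hs, hc⟩
    obtain ⟨g, -, hg⟩ := h2
    omega
  exact fun s hs s' hs' h => le_antisymm (key hs h) (key hs' h.symm)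

theorem IdealFiltration.IsMonomial.encard_gorensteinGradedIdeals {A : Type u} [CommRing A]
    {F : IdealFiltration A} (hF : F.IsMonomial) {c : ℕ} (hc : ∀ i, c ≤ i → i ∈ F.values)
    (hFr : ∀ k, k + 1 = c → k ∉ F.values)
    (hsymm : ∀ i j, i + j + 1 = c → i ∉ F.values → j ∈ F.values) :
    F.gorensteinGradedIdeals.encard = c := by
  have h0 := hF.zero_mem_values
  have hadd (i : ℕ) (hi : i ∈ F.values) (j : ℕ) (hj : j ∈ F.values) : i + j ∈ F.values :=
    hF.add_mem_values hi hj
  rw [← encard_setOf_not_exists_add_eq hc hFr h0]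
  -- One nonzero homogeneous element, of degree `d`, forces `I` to contain everything in degrees at
  -- least `d + c`; this makes the Artinian results applicable.
  have hN {I : Ideal F.AssociatedGraded} {d : ℕ} (hd : d ∈ degrees I) (i : ℕ) (hi : d + c ≤ i)
      (x : F.GrPiece i) : F.hom i x ∈ I := by
    refine hF.hom_mem_of_mem_degrees ?_ x
    have := hF.add_mem_degrees hd (hc (i - d) (by omega))
    rwa [Nat.add_sub_cancel' (by omega)] at this
  have hinj : Set.InjOn degrees F.gorensteinGradedIdeals := by
    intro I hI J hJ h
    ext f
    rw [hF.mem_iff_supported_degrees hI.1, hF.mem_iff_supported_degrees hJ.1, h]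
  have himage : degrees '' F.gorensteinGradedIdeals =
      nonDivisors F.values '' {s | s ∈ F.values ∧ ¬ ∃ a ∈ F.values, s + 1 = a + c} := by
    ext E
    constructor
    · rintro ⟨I, ⟨hI, hG, hrank⟩, rfl⟩
      rw [Submodule.two_le_spanRank_iff] at hrank
      have hI0 : I ≠ ⊥ := fun h => hrank ⟨0, by simp [h]⟩
      have hI1 : I ≠ ⊤ := fun h => hrank ⟨1, by rw [h]; exact Ideal.span_singleton_one.symm⟩
      obtain ⟨d, hd⟩ : ∃ d, d ∈ degrees I := by
        obtain ⟨f, hf, hf0⟩ := Submodule.exists_mem_ne_zero_of_ne_bot hI0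
        obtain ⟨d, hd⟩ : ∃ d, f d ≠ 0 := by
          by_contra! h
          exact hf0 (DFinsupp.ext h)
        exact ⟨d, f d, hd, hI f hf d⟩
      obtain ⟨s, hs, hE⟩ := hF.exists_degrees_eq_nonDivisors (hN hd) hI hI1 hG
      refine ⟨s, ⟨hs, fun ha => hrank ?_⟩, hE.symm⟩
      rw [← exists_nonDivisors_eq_iff h0 hadd hc hFr hsymm hs, ← hE] at ha
      exact (hF.exists_eq_span_singleton_iff hI hI0).2 ha
    · rintro ⟨s, ⟨hs, ha⟩, rfl⟩
      let I : Ideal F.AssociatedGraded := supportedIdeal (nonDivisors F.values s) (by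
        rintro i ⟨hi, hin⟩ j hj
        refine ⟨hadd i hi j hj, ?_⟩
        rintro ⟨g, hg, hgs⟩
        exact hin ⟨j + g, hadd j hj g hg, by omega⟩)
      have hI : F.IsGradedIdeal I := isGradedIdeal_supportedIdeal _ _
      have hE : degrees I = nonDivisors F.values s :=
        degrees_supportedIdeal _ fun _ h => h.1
      have hd : s + 1 + c ∈ degrees I := by
        rw [hE]
        exact ⟨hc _ (by omega), fun ⟨g, _, hg⟩ => by omega⟩
      have hI0 : I ≠ ⊥ := by
        intro h
        obtain ⟨x, hx, hxI⟩ := hd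
        rw [h, Ideal.mem_bot] at hxI
        exact hx (DirectSum.of_injective _ (hxI.trans (map_zero _).symm))
      refine ⟨I, ⟨hI, hF.isGorensteinRing_quotient (hN hd) hI hs hE, ?_⟩, hE⟩
      rw [Submodule.two_le_spanRank_iff]
      intro hf
      have := (hF.exists_eq_span_singleton_iff hI hI0).1 hf
      rw [hE, exists_nonDivisors_eq_iff h0 hadd hc hFr hsymm hs] at this
      exact ha this
  rw [← hinj.encard_image, himage, ((injOn_nonDivisors h0).mono fun _ h => h.1).encard_image]

/-! ### Orders in the valuation ring and the main theorem -/

section DiscreteValuation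

variable {V : Type*} [CommRing V] [IsDomain V] {t : V}

theorem mul_notMem_span_singleton_pow (ht0 : t ≠ 0) (ht : (Ideal.span {t}).IsPrime) {i j : ℕ}
    {x y : V} (hx : x ∈ Ideal.span {t} ^ i) (hx' : x ∉ Ideal.span {t} ^ (i + 1))
    (hy : y ∈ Ideal.span {t} ^ j) (hy' : y ∉ Ideal.span {t} ^ (j + 1)) :
    x * y ∉ Ideal.span {t} ^ (i + j + 1) := by
  simp only [Ideal.span_singleton_pow, Ideal.mem_span_singleton] at *
  rw [Ideal.span_singleton_prime ht0] at ht
  obtain ⟨u, rfl⟩ := hx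
  obtain ⟨w, rfl⟩ := hy
  have hi : t ^ i ≠ 0 := pow_ne_zero i ht0
  have hj : t ^ j ≠ 0 := pow_ne_zero j ht0
  rw [pow_succ, mul_dvd_mul_iff_left hi] at hx'
  rw [pow_succ, mul_dvd_mul_iff_left hj] at hy'
  rw [mul_mul_mul_comm, ← pow_add, pow_succ, mul_dvd_mul_iff_left (pow_ne_zero _ ht0)]
  exact fun h => (ht.dvd_or_dvd h).elim hx' hy'

omit [IsDomain V] in
theorem exists_sub_mul_mem_span_singleton_pow {A : Type*} [CommRing A] [Algebra A V]
    [IsLocalRing V] (ht : (Ideal.span {t}).IsMaximal)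
    (hA : ∀ v : V, ∃ a : A, v - algebraMap A V a ∈ Ideal.span {t}) {i : ℕ}
    {x y : V} (hx : x ∈ Ideal.span {t} ^ i) (hy : y ∈ Ideal.span {t} ^ i)
    (hy' : y ∉ Ideal.span {t} ^ (i + 1)) :
    ∃ a : A, x - algebraMap A V a * y ∈ Ideal.span {t} ^ (i + 1) := by
  simp only [Ideal.span_singleton_pow, Ideal.mem_span_singleton] at *
  obtain ⟨u, rfl⟩ := hx
  obtain ⟨w, rfl⟩ := hy
  have hw : IsUnit w := by
    rw [← IsLocalRing.notMem_maximalIdeal, ← IsLocalRing.eq_maximalIdeal ht,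
      Ideal.mem_span_singleton]
    exact fun h => hy' (by rw [pow_succ]; exact mul_dvd_mul_left _ h)
  obtain ⟨w, rfl⟩ := hw
  obtain ⟨a, ha⟩ := hA (u * ↑w⁻¹)
  refine ⟨a, ?_⟩
  have : t ^ i * u - algebraMap A V a * (t ^ i * w) =
      t ^ i * ((u * ↑w⁻¹ - algebraMap A V a) * w) := by
    have hw : (w : V) * ↑w⁻¹ = 1 := w.mul_inv
    linear_combination (-(t ^ i * u)) * hw
  rw [this, pow_succ]
  exact mul_dvd_mul_left _ (ha.mul_right _)

end DiscreteValuation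

theorem IsGorensteinRing.exists_sub_algebraMap_mul_mem_range {A : Type u} [CommRing A] [IsDomain A]
    [IsLocalRing A] [Ring.DimensionLEOne A] (hA : ¬ IsField A) (hGor : IsGorensteinRing A)
    (s s' : integralClosure A (FractionRing A)) (hs : s ∉ Set.range (algebraMap A _))
    (hms : ∀ r ∈ IsLocalRing.maximalIdeal A, algebraMap A _ r * s ∈ Set.range (algebraMap A _))
    (hms' : ∀ r ∈ IsLocalRing.maximalIdeal A, algebraMap A _ r * s' ∈ Set.range (algebraMap A _)) :
    ∃ r, s' - algebraMap A _ r * s ∈ Set.range (algebraMap A _) := by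
  have := hGor.1
  obtain ⟨d, hd⟩ := hGor.exists_hasInjectiveDimensionLE
  have hrange (v : integralClosure A (FractionRing A)) :
      (v : FractionRing A) ∈ Set.range (algebraMap A (FractionRing A)) ↔
        v ∈ Set.range (algebraMap A _) :=
    ⟨fun ⟨a, ha⟩ => ⟨a, Subtype.ext ha⟩, fun ⟨a, ha⟩ => ⟨a, congrArg Subtype.val ha⟩⟩
  have hsmul (r : A) (v : integralClosure A (FractionRing A)) :
      r • (v : FractionRing A) = ((algebraMap A _ r * v : integralClosure A (FractionRing A)) :
        FractionRing A) := by
    rw [← Algebra.smul_def]; rfl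
  obtain ⟨r, hr⟩ := IsLocalRing.exists_sub_smul_mem_range_of_hasInjectiveDimensionLE hA hd
    (s := (s : FractionRing A)) (s' := (s' : FractionRing A)) (by rwa [hrange])
    (fun r hr => by rw [hsmul, hrange]; exact hms r hr)
    (fun r hr => by rw [hsmul, hrange]; exact hms' r hr)
  refine ⟨r, (hrange _).1 ?_⟩
  rw [hsmul] at hr
  exact hr

theorem valueSemigroup_add_mem {A V : Type u} [CommRing A] [CommRing V] [IsDomain V] [Algebra A V]
    {t : V} (ht0 : t ≠ 0) (ht : (Ideal.span {t}).IsPrime) (i j : ℕ)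
    (hi : i ∈ valueSemigroup A (Ideal.span {t})) (hj : j ∈ valueSemigroup A (Ideal.span {t})) :
    i + j ∈ valueSemigroup A (Ideal.span {t}) := by
  rw [mem_valueSemigroup_iff] at hi hj ⊢
  obtain ⟨a, ha, ha'⟩ := hi
  obtain ⟨b, hb, hb'⟩ := hj
  refine ⟨a * b, ?_, ?_⟩
  · rw [map_mul, pow_add]
    exact Ideal.mul_mem_mul ha hb
  · rw [map_mul]
    exact mul_notMem_span_singleton_pow ht0 ht ha ha' hb hb'

theorem mainTheorem7 (A : Type u) [CommRing A] [IsDomain A] [IsLocalRing A]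
    (hGor : IsGorensteinRing A) (hdim : ringKrullDim A = 1)
    (hcomplete : IsAdicComplete (IsLocalRing.maximalIdeal A) A)
    (hclosed : IsAlgClosed (IsLocalRing.ResidueField A))
    (n : Ideal (integralClosure A (FractionRing A))) (hn : n.IsMaximal) :
    (inducedFiltration A n).gorensteinGradedIdeals.encard =
      (semigroupConductor (valueSemigroup A n) : ℕ∞) := by
  have hdim1 : Ring.KrullDimLE 1 A := Ring.krullDimLE_iff.2 (by rw [hdim]; simp)
  have hA1 : Ring.DimensionLEOne A :=
    ⟨fun hp hpp => Ring.krullDimLE_one_iff_of_noZeroDivisors.1 hdim1 _ hp hpp⟩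
  have hA : ¬ IsField A := by
    intro h
    rw [ringKrullDim_eq_zero_of_isField h] at hdim
    exact zero_ne_one hdim
  have := hGor.1
  let V := integralClosure A (FractionRing A)
  have hded : IsDedekindDomain V := integralClosure.isDedekindDomain_of_dimensionLEOne A
  have hfin : Module.Finite A V := integralClosure.finite_of_isAdicComplete A hA
  have hloc : IsLocalRing V := integralClosure.isLocalRing_of_isAdicComplete A hA
  have hnm : n = IsLocalRing.maximalIdeal V := IsLocalRing.eq_maximalIdeal hn
  have hmn (a : A) (ha : a ∈ IsLocalRing.maximalIdeal A) : algebraMap A V a ∈ n := by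
    have : n.comap (algebraMap A V) = IsLocalRing.maximalIdeal A :=
      IsLocalRing.eq_maximalIdeal (Ideal.isMaximal_comap_of_isIntegral_of_isMaximal n)
    rw [← this] at ha
    exact ha
  have hVA (v : V) : ∃ a : A, v - algebraMap A V a ∈ n :=
    n.exists_sub_algebraMap_mem_of_isAlgClosed v
  obtain ⟨N, hN⟩ := exists_pow_le_range_of_finite (integralClosure.exists_smul_eq_algebraMap A) n
  obtain ⟨t, rfl⟩ : ∃ t, n = Ideal.span {t} := by
    rw [hnm]
    exact (maximalIdeal_isPrincipal_of_isDedekindDomain V).principal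
  have ht0 : t ≠ 0 := by
    rintro rfl
    obtain ⟨x, hxm, hx0⟩ := Submodule.exists_mem_ne_zero_of_ne_bot
      (mt IsLocalRing.isField_iff_maximalIdeal_eq.2 hA)
    have := hmn x hxm
    rw [Ideal.mem_span_singleton, zero_dvd_iff, FaithfulSMul.algebraMap_eq_zero_iff] at this
    exact hx0 this
  have htu (k : ℕ) : t ^ k ∈ Ideal.span {t} ^ k ∧ t ^ k ∉ Ideal.span {t} ^ (k + 1) := by
    refine ⟨Ideal.pow_mem_pow (Ideal.mem_span_singleton_self t) k, fun h => hn.ne_top ?_⟩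
    rw [Ideal.span_singleton_pow, Ideal.mem_span_singleton, pow_succ] at h
    have h1 : t ^ k * t ∣ t ^ k * 1 := by rwa [mul_one]
    rw [mul_dvd_mul_iff_left (pow_ne_zero k ht0)] at h1
    exact Ideal.span_singleton_eq_top.2 (isUnit_of_dvd_one h1)
  have hone (i : ℕ) (x y : V) (hx : x ∈ Ideal.span {t} ^ i) (hy : y ∈ Ideal.span {t} ^ i)
      (hy' : y ∉ Ideal.span {t} ^ (i + 1)) :
      ∃ a : A, x - algebraMap A V a * y ∈ Ideal.span {t} ^ (i + 1) :=
    exists_sub_mul_mem_span_singleton_pow hn hVA hx hy hy'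
  have hvalues : (inducedFiltration A (Ideal.span {t})).values =
      valueSemigroup A (Ideal.span {t}) := Set.ext fun i => mem_valueSemigroup_iff.symm
  have hmono : (inducedFiltration A (Ideal.span {t})).IsMonomial := by
    refine ⟨fun h => ?_, fun i j x y hx hx' hy hy' h => ?_, fun i x y hx hy hy' => ?_⟩
    · change algebraMap A V 1 ∈ Ideal.span {t} ^ 1 at h
      rw [map_one, pow_one] at h
      exact hn.ne_top ((Ideal.eq_top_iff_one _).2 h)
    · change algebraMap A V (x * y) ∈ Ideal.span {t} ^ (i + j + 1) at h
      rw [map_mul] at h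
      exact mul_notMem_span_singleton_pow ht0 hn.isPrime hx hx' hy hy' h
    · obtain ⟨a, ha⟩ := hone i _ _ hx hy hy'
      refine ⟨a, ?_⟩
      change algebraMap A V (x - a * y) ∈ Ideal.span {t} ^ (i + 1)
      rwa [map_sub, map_mul]
  have hcond : ∃ c, ∀ m, c ≤ m → m ∈ valueSemigroup A (Ideal.span {t}) := by
    refine ⟨N, fun m hm => ?_⟩
    obtain ⟨a, ha⟩ := hN _ (Ideal.pow_le_pow_right hm (htu m).1)
    exact mem_valueSemigroup_iff.2 ⟨a, by rw [ha]; exact (htu m).1, by rw [ha]; exact (htu m).2⟩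
  have hspec := semigroupConductor_spec hcond
  have hrange := mem_range_of_mem_pow hone hN hspec
  refine hmono.encard_gorensteinGradedIdeals (hvalues ▸ hspec)
    -- The remaining goal is symmetry, with Frobenius number `F = i + j`.
    (fun k hk => hvalues ▸ semigroupConductor_pred_notMem hcond hk) fun i j hij hi => ?_
  rw [hvalues] at hi ⊢
  have hc1 : i + j + 1 = semigroupConductor (valueSemigroup A (Ideal.span {t})) := hij
  have := mem_valueSemigroup_of_notMem (F := i + j) hone
    (valueSemigroup_add_mem ht0 hn.isPrime) (fun k => ⟨_, htu k⟩) hmn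
    (hGor.exists_sub_algebraMap_mul_mem_range hA) (hc1 ▸ hrange)
    (semigroupConductor_pred_notMem hcond hc1) (Nat.le_add_right i j) hi
  rwa [Nat.add_sub_cancel_left] at this
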